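/- Let $0<p<1$ and let $\Omega=(-1,1)$. Fix $K\ge 1$ data points $x_1,\dots,x_K\in\mathbb R$, encoder mapping points $\alpha_1<\dots<\alpha_K$ in $\Omega$ and, for every number $N$ of servers, decoder mapping points $\beta_1<\dots<\beta_N$ in $\Omega$ (depending on $N$). With $\beta_0:=-1$, $\beta_{N+1}:=1$, $\Delta_{\max}:=\max_{0\le n\le N}(\beta_{n+1}-\beta_n)$ and $\Delta_{\min}:=\min_{1\le n\le N-1}(\beta_{n+1}-\beta_n)$, assume that $\Delta_{\max}/\Delta_{\min}\le B$ for a constant $B>0$ and all $N\ge 2$. Each server is a straggler with probability $p$, independently of the others; $\mathcal F\subseteq\{1,\dots,N\}$ denotes the random set of non-stragglers. For a function $f:\mathbb R\to\mathbb R$, an encoder $u_{\rm enc}$ and decoder functions $u_{{\rm dec},\mathcal F}$, computed from the results $f(u_{\rm enc}(\beta_v))$, $v\in\mathcal F$, let $$\ell_N(\mathcal F):=\frac1K\sum_{k=1}^K\bigl(u_{{\rm dec},\mathcal F}(\alpha_k)-f(x_k)\bigr)^2 ,\qquad \mathcal L_N:=\mathbb E_{\mathcal F}[\ell_N(\mathcal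 F)].$$ (LeTCC) Let $f$ be Lipschitz and twice differentiable with bounded second derivative, let $u_{\rm enc}$ be a natural cubic spline with knots $\alpha_1,\dots,\alpha_K$ and $u_{\rm enc}(\alpha_k)=x_k$ for all $k$, and let $0\le\lambda_N\le N^{-4}$. For $\mathcal F\ne\emptyset$ let $u_{{\rm dec},\mathcal F}$ be a minimizer over the Sobolev space $H^2(\Omega)$ of $$u\mapsto\frac1{|\mathcal F|}\sum_{v\in\mathcal F}\bigl(u(\beta_v)-f(u_{\rm enc}(\beta_v))\bigr)^2+\lambda_N\int_\Omega u''(t)^2\,dt$$ (if $\lambda_N=0$: a minimizer for which $\int_\Omega (u'')^2$ is least). Then $\ell_N$ converges to zero with high probability at the rate $\log_{1/p}^3(N)/N^3$: for every $\varepsilon>0$, $\Pr(\ell_N\le\varepsilon)\to1$, and there is a constant $C$ such that for every $\delta\in(0,1)$ there is $n_0$ with $$\Pr\Bigl(\ell_N\le C\,\frac{\log_{1/p}^3(N)}{N^3}\Bigr)\ge 1-\delta\qquad\text{for all }N>n_0 .$$ If moreover the values $u_{{\rm dec},\mathcal F}(\alpha_k)$ for $|\mathcal F|<2$ (where the minimizer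 is not unique or not defined) are chosen bounded by a constant independent of $N$, then $\mathcal L_N\to0$ and $\mathcal L_N=O\bigl(\log_{1/p}^3(N)/N^3\bigr)$. (BACC) Let $f\in C^2(\mathbb R)$, let $u_{\rm enc}$ be Berrut's rational interpolant of the data $(\alpha_k,x_k)$, $1\le k\le K$, and let $u_{{\rm dec},\mathcal F}$ be Berrut's rational interpolant of the data $(\beta_v,f(u_{\rm enc}(\beta_v)))$, $v\in\mathcal F$ (and $0$ if $\mathcal F=\emptyset$). Here Berrut's interpolant of data $(t_i,y_i)$, $1\le i\le n$, $t_1<\dots<t_n$, is $z\mapsto\sum_i\frac{(-1)^i}{z-t_i}y_i\big/\sum_i\frac{(-1)^i}{z-t_i}$, with value $y_i$ at $t_i$. Then $\ell_N$ converges to zero with high probability, in the same sense, at the rate $\log_{1/p}^4(N)/N^2$; moreover $\mathcal L_N\to0$ and $\mathcal L_N=O\bigl(\log_{1/p}^4(N)/N^2\bigr)$. -/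

import Mathlib

open Filter Topology MeasureTheory

noncomputable section

namespace CodedComputing

/-- The domain `Ω = (-1, 1)`, which contains all mapping points. -/
def Omega : Set ℝ := Set.Ioo (-1) 1

/-! ### Random stragglers

The `N` servers are indexed by `Fin N`; `F : Finset (Fin N)` is the set of servers that respond. -/

/-- The probability that `F` is exactly the set of non-stragglers, when each server is a straggler
with probability `p`, independently of the others. -/
def responseWeight (p : ℝ) {N : ℕ} (F : Finset (Fin N)) : ℝ :=
  ∏ n : Fin N, if n ∈ F then 1 - p else p

/-- Expectation of `X F`, where `F` is the random set of non-stragglers. -/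
def expectation (p : ℝ) {N : ℕ} (X : Finset (Fin N) → ℝ) : ℝ :=
  ∑ F : Finset (Fin N), responseWeight p F * X F

/-- Probability that the random set of non-stragglers belongs to `A`. -/
def probability (p : ℝ) {N : ℕ} (A : Set (Finset (Fin N))) : ℝ :=
  expectation p (A.indicator fun _ => 1)

/-! ### Decoder mapping points -/

/-- The points `β₁ < ⋯ < β_N` (at positions `1, …, N`) completed by the end points of `Ω`:
`β₀ = -1` and `β_{N+1} = 1`. -/
def extendedNode {N : ℕ} (β : Fin N → ℝ) (n : ℕ) : ℝ :=
  if n = 0 then -1 else if h : n - 1 < N then β ⟨n - 1, h⟩ else 1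

/-- `Δ_max`, the largest of the `N + 1` gaps `β_{n+1} - β_n`, `0 ≤ n ≤ N`. -/
def deltaMax {N : ℕ} (β : Fin N → ℝ) : ℝ :=
  ⨆ n : Fin (N + 1), (extendedNode β (n + 1) - extendedNode β n)

/-- `Δ_min`, the smallest of the `N - 1` gaps `β_{n+1} - β_n`, `1 ≤ n ≤ N - 1`
(meaningful for `2 ≤ N`). -/
def deltaMin {N : ℕ} (β : Fin N → ℝ) : ℝ :=
  ⨅ n : Fin (N - 1), (extendedNode β (n + 2) - extendedNode β (n + 1))

/-! ### Berrut's rational interpolation (BACC) -/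

/-- The alternating sign of the node `v` among the nodes of `F`: `(-1)` to the number of elements
of `F` below `v`. -/
def alternatingSign {n : ℕ} (F : Finset (Fin n)) (v : Fin n) : ℝ :=
  (-1) ^ (F.filter (· < v)).card

open Classical in
/-- Berrut's rational interpolant of the data `(t v, y v)`, `v ∈ F`. At a node the quotient is to
be read as its limit, the datum at that node. -/
def berrut {n : ℕ} (t y : Fin n → ℝ) (F : Finset (Fin n)) (z : ℝ) : ℝ :=
  if h : ∃ v ∈ F, t v = z then y h.choose
  else (∑ v ∈ F, alternatingSign F v / (z - t v) * y v) /
    ∑ v ∈ F, alternatingSign F v / (z - t v)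

/-- The BACC encoder: the Berrut interpolant of `(α k, x k)`, for all `k`. -/
def baccEncoder {K : ℕ} (α x : Fin K → ℝ) : ℝ → ℝ :=
  berrut α x Finset.univ

/-- The BACC decoder: the Berrut interpolant of the results `f (enc (β v))`, `v ∈ F`. -/
def baccDecoder (f enc : ℝ → ℝ) {N : ℕ} (β : Fin N → ℝ) (F : Finset (Fin N)) : ℝ → ℝ :=
  berrut β (fun v => f (enc (β v))) F

/-! ### Smoothing splines (LeTCC) -/

/-- The second-order Sobolev space `H²(Ω)`, realised by its continuous representatives: `u` is
differentiable on `Ω`, `u'` is absolutely continuous and `u'' ∈ L²(Ω)`. -/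
structure MemH2 (u : ℝ → ℝ) : Prop where
  differentiableOn : DifferentiableOn ℝ u Omega
  absolutelyContinuous : ∀ a ∈ Omega, ∀ b ∈ Omega, AbsolutelyContinuousOnInterval (deriv u) a b
  memLp : MemLp (deriv (deriv u)) 2 (volume.restrict Omega)

/-- The roughness `∫_Ω (u'')²`. -/
def roughness (u : ℝ → ℝ) : ℝ := ∫ t in Omega, (deriv (deriv u) t) ^ 2

/-- The penalised least-squares objective of the LeTCC decoder. -/
def letccObjective (f enc : ℝ → ℝ) {N : ℕ} (β : Fin N → ℝ) (lam : ℝ) (F : Finset (Fin N))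
    (u : ℝ → ℝ) : ℝ :=
  (1 / (F.card : ℝ)) * ∑ v ∈ F, (u (β v) - f (enc (β v))) ^ 2 + lam * roughness u

/-- `u` minimises the LeTCC decoder objective over `H²(Ω)`. -/
def IsLetccMinimizer (f enc : ℝ → ℝ) {N : ℕ} (β : Fin N → ℝ) (lam : ℝ) (F : Finset (Fin N))
    (u : ℝ → ℝ) : Prop :=
  MemH2 u ∧ ∀ w, MemH2 w → letccObjective f enc β lam F u ≤ letccObjective f enc β lam F w

/-- `u` is a LeTCC decoder function for the responses of `F`: a minimiser of the objective. In the
non-smooth version `lam = 0`, where every interpolant is a minimiser, it is one of least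
roughness (the limit `lam → 0`). -/
def IsLetccDecoder (f enc : ℝ → ℝ) {N : ℕ} (β : Fin N → ℝ) (lam : ℝ) (F : Finset (Fin N))
    (u : ℝ → ℝ) : Prop :=
  IsLetccMinimizer f enc β lam F u ∧
    (lam = 0 → ∀ w, IsLetccMinimizer f enc β lam F w → roughness u ≤ roughness w)

/-- `u` is a natural cubic spline with knots `α₁ < ⋯ < α_K`: it is of class `C²`, a polynomial of
degree at most `3` between consecutive knots, and affine to the left of the first knot and to the
right of the last one. -/
structure IsNaturalSpline {K : ℕ} (α : Fin K → ℝ) (u : ℝ → ℝ) : Prop where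
  contDiff : ContDiff ℝ 2 u
  cubic : ∀ i j : Fin K, (j : ℕ) = i + 1 →
    ∃ P : Polynomial ℝ, P.natDegree ≤ 3 ∧ ∀ z ∈ Set.Icc (α i) (α j), u z = P.eval z
  affine_left : ∃ P : Polynomial ℝ, P.natDegree ≤ 1 ∧ ∀ z, (∀ i, z ≤ α i) → u z = P.eval z
  affine_right : ∃ P : Polynomial ℝ, P.natDegree ≤ 1 ∧ ∀ z, (∀ i, α i ≤ z) → u z = P.eval z

/-! ### Approximation error and its convergence -/

/-- The approximation error `(1/K) ∑ₖ (dec (α k) - f (x k))²` of the decoder function `dec`,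
which was computed from the responses of one set of non-stragglers. -/
def approxError {K : ℕ} (α x : Fin K → ℝ) (f dec : ℝ → ℝ) : ℝ :=
  (1 / (K : ℝ)) * ∑ k : Fin K, (dec (α k) - f (x k)) ^ 2

/-- With high probability over the stragglers, the error `err N F` tends to zero and is at most a
constant times `rate N`: for one constant `C` and every `δ ∈ (0, 1)` this holds with probability at
least `1 - δ` as soon as `N` is large. -/
def ConvergesWithHighProbability (p : ℝ) (err : (N : ℕ) → Finset (Fin N) → ℝ)
    (rate : ℕ → ℝ) : Prop :=
  (∀ ε : ℝ, 0 < ε → Tendsto (fun N => probability p {F | err N F ≤ ε}) atTop (𝓝 1)) ∧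
  ∃ C : ℝ, ∀ δ : ℝ, 0 < δ → δ < 1 → ∃ n₀ : ℕ, ∀ N : ℕ, n₀ < N →
    1 - δ ≤ probability p {F | err N F ≤ C * rate N}

/-- The expectation over the stragglers of the error `err N F` tends to zero and is `O(rate N)`. -/
def ConvergesInMean (p : ℝ) (err : (N : ℕ) → Finset (Fin N) → ℝ) (rate : ℕ → ℝ) : Prop :=
  Tendsto (fun N => expectation p (err N)) atTop (𝓝 0) ∧
  (fun N => expectation p (err N)) =O[atTop] rate

end CodedComputing

end

/-!
A union bound over windows of `⌈6 log_{1/p} N⌉` consecutive servers shows that, outside an event of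
probability `O(N⁻⁵)`, every window contains a responding server. Quasi-uniformity of the mapping
points then puts a responding one on either side of every `α k`, at distance `d = O(log N / N)`.

*LeTCC.* Comparing the decoder `u` with `g = f ∘ enc` in the objective bounds the roughness of `u`
by that of `g`, and every residual at a responding point by `O(N^{-3/2})`. The derivative of
`u - g` is Hölder continuous of exponent `1/2`, so linear interpolation between two neighbouring
points gives `(u - g)² = O(N⁻³ + d³)`.

*BACC.* The denominator of Berrut's interpolant is an alternating sum of the `1 / (z - β v)`, which
pairing consecutive terms bounds below by `δ / (d (d + δ))`, where `δ` is of order `1 / N`. The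
numerator of the error is an alternating sum of difference quotients of `g`; it is bounded because
`g'` has bounded variation. Hence the error is `O(d (d + δ) / δ) = O(log² N / N)`.

On the exceptional event both errors are at most `O(N)`, which its probability compensates for.
-/

namespace CodedComputing

/-! ### The random set of responses -/

section Probability

variable {p : ℝ} {N : ℕ}

lemma sum_responseWeight (p : ℝ) (N : ℕ) : ∑ F : Finset (Fin N), responseWeight p F = 1 := by
  simpa [responseWeight, Finset.prod_ite, Finset.filter_not, Finset.compl_eq_univ_sdiff]
    using (Fintype.prod_add (fun _ : Fin N => 1 - p) fun _ => p).symm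

lemma responseWeight_nonneg (hp0 : 0 ≤ p) (hp1 : p ≤ 1) (F : Finset (Fin N)) :
    0 ≤ responseWeight p F :=
  Finset.prod_nonneg fun n _ => by split_ifs <;> linarith

lemma expectation_mono (hp0 : 0 ≤ p) (hp1 : p ≤ 1) {X Y : Finset (Fin N) → ℝ}
    (h : ∀ F, X F ≤ Y F) : expectation p X ≤ expectation p Y :=
  Finset.sum_le_sum fun F _ => mul_le_mul_of_nonneg_left (h F) (responseWeight_nonneg hp0 hp1 F)

lemma expectation_const (p c : ℝ) (N : ℕ) :
    expectation p (fun _ : Finset (Fin N) => c) = c := by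
  rw [expectation, ← Finset.sum_mul, sum_responseWeight, one_mul]

lemma expectation_nonneg (hp0 : 0 ≤ p) (hp1 : p ≤ 1) {X : Finset (Fin N) → ℝ}
    (h : ∀ F, 0 ≤ X F) : 0 ≤ expectation p X :=
  Finset.sum_nonneg fun F _ => mul_nonneg (responseWeight_nonneg hp0 hp1 F) (h F)

lemma expectation_add (p : ℝ) (X Y : Finset (Fin N) → ℝ) :
    expectation p (fun F => X F + Y F) = expectation p X + expectation p Y := by
  simp only [expectation, mul_add, Finset.sum_add_distrib]

lemma expectation_const_mul (p c : ℝ) (X : Finset (Fin N) → ℝ) :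
    expectation p (fun F => c * X F) = c * expectation p X := by
  simp only [expectation, Finset.mul_sum, mul_left_comm]

lemma expectation_sum (p : ℝ) {ι : Type*} (s : Finset ι) (X : ι → Finset (Fin N) → ℝ) :
    expectation p (fun F => ∑ i ∈ s, X i F) = ∑ i ∈ s, expectation p (X i) := by
  simp only [expectation, Finset.mul_sum]
  exact Finset.sum_comm

lemma probability_nonneg (hp0 : 0 ≤ p) (hp1 : p ≤ 1) (A : Set (Finset (Fin N))) :
    0 ≤ probability p A :=
  expectation_nonneg hp0 hp1 fun F => Set.indicator_nonneg (fun _ _ => zero_le_one) F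

lemma probability_mono (hp0 : 0 ≤ p) (hp1 : p ≤ 1) {A B : Set (Finset (Fin N))} (h : A ⊆ B) :
    probability p A ≤ probability p B :=
  expectation_mono hp0 hp1 (Set.indicator_le_indicator_of_subset h fun _ => zero_le_one)

lemma probability_le_one (hp0 : 0 ≤ p) (hp1 : p ≤ 1) (A : Set (Finset (Fin N))) :
    probability p A ≤ 1 :=
  (expectation_mono hp0 hp1 (Set.indicator_le_self' fun _ _ => zero_le_one)).trans_eq
    (expectation_const p 1 N)

lemma probability_add_compl (p : ℝ) (A : Set (Finset (Fin N))) :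
    probability p A + probability p Aᶜ = 1 := by
  rw [probability, probability, ← expectation_add]
  exact (congrArg _ (Set.indicator_self_add_compl A _)).trans (expectation_const p 1 N)

lemma probability_biUnion_le (hp0 : 0 ≤ p) (hp1 : p ≤ 1) {ι : Type*} (s : Finset ι)
    (A : ι → Set (Finset (Fin N))) :
    probability p (⋃ i ∈ s, A i) ≤ ∑ i ∈ s, probability p (A i) := by
  simp only [probability, ← expectation_sum]
  refine expectation_mono hp0 hp1 fun F => Set.indicator_apply_le' (fun hF => ?_) fun _ =>
    Finset.sum_nonneg fun i _ => Set.indicator_nonneg (fun _ _ => zero_le_one) F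
  obtain ⟨i, hi, hFi⟩ := Set.mem_iUnion₂.1 hF
  calc (1 : ℝ) = (A i).indicator (fun _ => 1) F := by rw [Set.indicator_of_mem hFi]
    _ ≤ ∑ i ∈ s, (A i).indicator (fun _ => 1) F :=
      Finset.single_le_sum (f := fun i => (A i).indicator (fun _ => (1 : ℝ)) F)
        (fun i _ => Set.indicator_nonneg (fun _ _ => zero_le_one) F) hi

lemma probability_disjoint (p : ℝ) (W : Finset (Fin N)) :
    probability p {F | Disjoint W F} = p ^ W.card := by
  classical
  have hweight (F : Finset (Fin N)) :
      responseWeight p F * ({F | Disjoint W F} : Set (Finset (Fin N))).indicator (fun _ => 1) F =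
        (∏ n ∈ F, if n ∈ W then 0 else 1 - p) * ∏ _n ∈ Fᶜ, p := by
    by_cases hF : Disjoint W F
    · rw [Set.indicator_of_mem (by exact hF), mul_one, responseWeight, Finset.prod_ite]
      congr 1
      · rw [Finset.filter_mem_eq_inter, Finset.univ_inter]
        exact Finset.prod_congr rfl fun n hn => (if_neg (Finset.disjoint_right.1 hF hn)).symm
      · rw [Finset.filter_not, Finset.filter_mem_eq_inter, Finset.univ_inter,
          Finset.compl_eq_univ_sdiff]
    · obtain ⟨n, hnW, hnF⟩ := Finset.not_disjoint_iff.1 hF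
      rw [Set.indicator_of_notMem (by exact hF), mul_zero,
        Finset.prod_eq_zero (M₀ := ℝ) hnF (if_pos hnW), zero_mul]
  have hfactor (n : Fin N) : (if n ∈ W then 0 else 1 - p) + p = if n ∈ W then p else 1 := by
    split_ifs <;> ring
  simp only [probability, expectation, hweight]
  rw [← Fintype.prod_add (fun n => if n ∈ W then 0 else 1 - p) fun _ => p]
  simp only [hfactor, Finset.prod_ite_mem, Finset.univ_inter, Finset.prod_const]

lemma expectation_le_add_mul_probability (hp0 : 0 ≤ p) (hp1 : p ≤ 1) {X : Finset (Fin N) → ℝ}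
    {A : Set (Finset (Fin N))} {a b : ℝ} (ha : 0 ≤ a) (hA : ∀ F ∈ A, X F ≤ a)
    (hX : ∀ F, X F ≤ b) : expectation p X ≤ a + b * probability p Aᶜ := by
  suffices expectation p X ≤ expectation p fun F => a + b * Aᶜ.indicator (fun _ => 1) F by
    rwa [expectation_add, expectation_const, expectation_const_mul] at this
  refine expectation_mono hp0 hp1 fun F => ?_
  by_cases hF : F ∈ A
  · simpa [hF] using hA F hF
  · simpa [hF] using (hX F).trans (le_add_of_nonneg_left ha)

end Probability

section Convergence

variable {p : ℝ} {err : (N : ℕ) → Finset (Fin N) → ℝ} {rate : ℕ → ℝ}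
  {good : (N : ℕ) → Set (Finset (Fin N))} {C : ℝ}

lemma convergesWithHighProbability_of_eventually_le (hp0 : 0 ≤ p) (hp1 : p ≤ 1)
    (hgood : Tendsto (fun N => probability p (good N)ᶜ) atTop (𝓝 0))
    (hrate : Tendsto rate atTop (𝓝 0))
    (herr : ∀ᶠ N in atTop, ∀ F ∈ good N, err N F ≤ C * rate N) :
    ConvergesWithHighProbability p err rate := by
  have hprob : Tendsto (fun N => probability p (good N)) atTop (𝓝 1) := by
    have h := hgood.const_sub 1
    rw [sub_zero] at h
    exact h.congr fun N => sub_eq_of_eq_add (probability_add_compl p (good N)).symm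
  have hle : ∀ᶠ N in atTop, probability p (good N) ≤ probability p {F | err N F ≤ C * rate N} :=
    herr.mono fun N hN => probability_mono hp0 hp1 hN
  constructor
  · intro ε hε
    have hsmall : ∀ᶠ N in atTop, C * rate N ≤ ε := by
      have h := hrate.const_mul C
      rw [mul_zero] at h
      exact h.eventually_le_const hε
    refine tendsto_of_tendsto_of_tendsto_of_le_of_le' hprob tendsto_const_nhds ?_
      (.of_forall fun N => probability_le_one hp0 hp1 _)
    filter_upwards [hle, hsmall] with N hN hε
    exact hN.trans (probability_mono hp0 hp1 fun F hF => le_trans hF hε)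
  · refine ⟨C, fun δ hδ _ => ?_⟩
    obtain ⟨n₀, hn₀⟩ := eventually_atTop.1
      ((hprob.eventually_const_le (sub_lt_self 1 hδ)).and hle)
    exact ⟨n₀, fun N hN => (hn₀ N hN.le).1.trans (hn₀ N hN.le).2⟩

lemma convergesInMean_of_eventually_le (hp0 : 0 ≤ p) (hp1 : p ≤ 1) {D : ℕ → ℝ}
    (hbad : (fun N => D N * probability p (good N)ᶜ) =O[atTop] rate)
    (hrate : Tendsto rate atTop (𝓝 0)) (hnonneg : ∀ N F, 0 ≤ err N F)
    (herr : ∀ᶠ N in atTop, ∀ F ∈ good N, err N F ≤ C * rate N)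
    (hD : ∀ᶠ N in atTop, ∀ F, err N F ≤ D N) :
    ConvergesInMean p err rate := by
  have hO : (fun N => expectation p (err N)) =O[atTop] rate := by
    have hsum : (fun N => ‖C * rate N‖ + D N * probability p (good N)ᶜ) =O[atTop] rate :=
      ((Asymptotics.isBigO_refl rate atTop).const_mul_left C).norm_left.add hbad
    refine Asymptotics.IsBigO.trans (.of_norm_eventuallyLE ?_) hsum
    filter_upwards [herr, hD] with N hN hDN
    rw [Real.norm_of_nonneg (expectation_nonneg hp0 hp1 (hnonneg N))]
    exact expectation_le_add_mul_probability hp0 hp1 (norm_nonneg _)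
      (fun F hF => (hN F hF).trans (le_abs_self _)) hDN
  exact ⟨hO.trans_tendsto hrate, hO⟩

end Convergence

/-! ### Runs of stragglers -/

/-- Every window of `L` consecutive servers contains a non-straggler. Servers are counted from
`0`, as in `Fin N`. -/
def HitsWindows (L : ℕ) {N : ℕ} (F : Finset (Fin N)) : Prop :=
  ∀ i, i + L ≤ N → ∃ n ∈ F, (n : ℕ) ∈ Set.Ico i (i + L)

/-- The length `⌈6 log_{1/p} N⌉` of the windows: long enough for a run of as many stragglers to
have probability at most `N⁻⁶`. -/
noncomputable def windowLength (p : ℝ) (N : ℕ) : ℕ := ⌈6 * Real.logb (1 / p) N⌉₊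

section Windows

variable {p : ℝ} {N : ℕ}

lemma probability_not_hitsWindows_le (hp0 : 0 ≤ p) (hp1 : p ≤ 1) (L N : ℕ) :
    probability p {F : Finset (Fin N) | HitsWindows L F}ᶜ ≤ (N + 1 - L : ℕ) * p ^ L := by
  let W (i : Fin (N + 1 - L)) : Finset (Fin N) :=
    (Finset.Ico (i : ℕ) (i + L)).attachFin fun n hn => by
      have := (Finset.mem_Ico.1 hn).2
      omega
  have hsub : {F : Finset (Fin N) | HitsWindows L F}ᶜ ⊆
      ⋃ i ∈ Finset.univ, {F | Disjoint (W i) F} := by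
    intro F hF
    obtain ⟨i, hi, hmiss⟩ : ∃ i, i + L ≤ N ∧ ∀ n ∈ F, (n : ℕ) ∉ Set.Ico i (i + L) := by
      simpa [HitsWindows] using hF
    refine Set.mem_iUnion₂.2 ⟨⟨i, by omega⟩, Finset.mem_univ _, Finset.disjoint_right.2 ?_⟩
    simpa [W] using hmiss
  calc probability p {F : Finset (Fin N) | HitsWindows L F}ᶜ
      ≤ ∑ i, probability p {F | Disjoint (W i) F} :=
        (probability_mono hp0 hp1 hsub).trans (probability_biUnion_le hp0 hp1 _ _)
    _ = (N + 1 - L : ℕ) * p ^ L := by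
        simp [probability_disjoint, W]

lemma tendsto_logb_natCast (hp0 : 0 < p) (hp1 : p < 1) :
    Tendsto (fun N : ℕ => Real.logb (1 / p) N) atTop atTop :=
  (Real.tendsto_logb_atTop (one_lt_one_div hp0 hp1)).comp tendsto_natCast_atTop_atTop

lemma tendsto_logb_pow_div_pow (p : ℝ) (a : ℕ) {b : ℕ} (hb : b ≠ 0) :
    Tendsto (fun N : ℕ => Real.logb (1 / p) N ^ a / (N : ℝ) ^ b) atTop (𝓝 0) := by
  have hlog : Tendsto (fun N : ℕ => Real.log N ^ a / (N : ℝ) ^ b) atTop (𝓝 0) := by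
    refine Asymptotics.IsLittleO.tendsto_div_nhds_zero (Asymptotics.IsLittleO.comp_tendsto ?_
      tendsto_natCast_atTop_atTop (f := fun x : ℝ => Real.log x ^ a) (g := fun x : ℝ => x ^ b))
    simpa using isLittleO_log_rpow_rpow_atTop a (s := b) (by positivity)
  have h := hlog.div_const (Real.log (1 / p) ^ a)
  rw [zero_div] at h
  exact h.congr fun N => by rw [Real.logb, div_pow, div_right_comm]

lemma windowLength_le (h : 1 ≤ Real.logb (1 / p) N) :
    (windowLength p N : ℝ) ≤ 7 * Real.logb (1 / p) N := by
  have := Nat.ceil_lt_add_one (a := 6 * Real.logb (1 / p) N) (by linarith)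
  rw [windowLength]
  linarith

lemma one_le_windowLength (h : 1 ≤ Real.logb (1 / p) N) : 1 ≤ windowLength p N :=
  Nat.ceil_pos.2 (by linarith)

lemma pow_windowLength_le (hp0 : 0 < p) (hp1 : p < 1) (hN : 0 < N) :
    p ^ windowLength p N ≤ 1 / (N : ℝ) ^ 6 := by
  have hlogb : p ^ Real.logb (1 / p) N = (N : ℝ)⁻¹ := by
    rw [one_div, Real.logb_inv_base, Real.rpow_neg hp0.le,
      Real.rpow_logb hp0 hp1.ne (by exact_mod_cast hN)]
  calc p ^ windowLength p N = p ^ (windowLength p N : ℝ) := (Real.rpow_natCast _ _).symm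
    _ ≤ p ^ (Real.logb (1 / p) N * (6 : ℕ)) :=
      Real.rpow_le_rpow_of_exponent_ge hp0 hp1.le (by
        rw [mul_comm]
        exact Nat.le_ceil _)
    _ = 1 / (N : ℝ) ^ 6 := by
      rw [Real.rpow_mul hp0.le, hlogb, Real.rpow_natCast, inv_pow, one_div]

lemma probability_not_hitsWindows_windowLength_le (hp0 : 0 < p) (hp1 : p < 1)
    (hN : 1 ≤ Real.logb (1 / p) N) :
    probability p {F : Finset (Fin N) | HitsWindows (windowLength p N) F}ᶜ ≤ 1 / (N : ℝ) ^ 5 := by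
  have hN0 : 0 < N := Nat.pos_of_ne_zero fun h => by simp [h] at hN; linarith
  have hN' : (0 : ℝ) < N := Nat.cast_pos.2 hN0
  have hL := one_le_windowLength hN
  calc probability p {F : Finset (Fin N) | HitsWindows (windowLength p N) F}ᶜ
      ≤ (N + 1 - windowLength p N : ℕ) * p ^ windowLength p N :=
        probability_not_hitsWindows_le hp0.le hp1.le _ N
    _ ≤ N * (1 / (N : ℝ) ^ 6) :=
        mul_le_mul (Nat.cast_le.2 (by omega)) (pow_windowLength_le hp0 hp1 hN0) (by positivity)
          hN'.le
    _ = 1 / (N : ℝ) ^ 5 := by field_simp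

end Windows

/-! ### Decoder mapping points -/

/-- `β₁ < ⋯ < β_N` are points of `Ω`, at least two of them, whose gaps satisfy
`Δ_max / Δ_min ≤ B`. -/
structure IsQuasiUniform (B : ℝ) {N : ℕ} (β : Fin N → ℝ) : Prop where
  two_le : 2 ≤ N
  strictMono : StrictMono β
  mem_Omega : ∀ n, β n ∈ Omega
  ratio_le : deltaMax β / deltaMin β ≤ B

/-- `z` has, within distance `d` on either side, a mapping point of a responding server. The
point on the left may be `z` itself. -/
def HasNeighbours {N : ℕ} (β : Fin N → ℝ) (F : Finset (Fin N)) (d z : ℝ) : Prop :=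
  (∃ v ∈ F, β v ∈ Set.Icc (z - d) z) ∧ ∃ w ∈ F, β w ∈ Set.Ioc z (z + d)

section Nodes

variable {N : ℕ} {β : Fin N → ℝ} {B : ℝ}

lemma extendedNode_zero (β : Fin N → ℝ) : extendedNode β 0 = -1 := if_pos rfl

lemma extendedNode_val_add_one (β : Fin N → ℝ) (v : Fin N) : extendedNode β (v + 1) = β v := by
  simp [extendedNode]

lemma extendedNode_of_lt (β : Fin N → ℝ) {n : ℕ} (hn : N < n) : extendedNode β n = 1 := by
  rw [extendedNode, if_neg (by omega), dif_neg (by omega)]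

lemma extendedNode_add_sub_le (β : Fin N → ℝ) {n k : ℕ} (hn : n + k ≤ N + 1) :
    extendedNode β (n + k) - extendedNode β n ≤ k * deltaMax β := by
  induction k with
  | zero => simp
  | succ k ih =>
    have hgap : extendedNode β (n + k + 1) - extendedNode β (n + k) ≤ deltaMax β :=
      le_ciSup (f := fun n : Fin (N + 1) => extendedNode β (n + 1) - extendedNode β n)
        (Set.finite_range _).bddAbove ⟨n + k, by omega⟩
    rw [← add_assoc]
    push_cast
    linarith [ih (by omega)]

lemma deltaMin_le {n : ℕ} (hn : n + 1 < N) :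
    deltaMin β ≤ extendedNode β (n + 2) - extendedNode β (n + 1) :=
  ciInf_le (f := fun n : Fin (N - 1) => extendedNode β (n + 2) - extendedNode β (n + 1))
    (Set.finite_range _).bddBelow ⟨n, by omega⟩

lemma mul_deltaMin_le_extendedNode_sub {k : ℕ} (hk : k < N) :
    k * deltaMin β ≤ extendedNode β (k + 1) - extendedNode β 1 := by
  induction k with
  | zero => simp
  | succ k ih =>
    push_cast
    linarith [ih (by omega), deltaMin_le (β := β) hk]

lemma two_le_mul_deltaMax (β : Fin N → ℝ) : 2 ≤ (N + 1) * deltaMax β := by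
  have h := extendedNode_add_sub_le β (n := 0) (k := N + 1) (by omega)
  rw [extendedNode_zero, zero_add, extendedNode_of_lt β (by omega)] at h
  push_cast at h
  linarith

lemma deltaMax_pos (β : Fin N → ℝ) : 0 < deltaMax β :=
  pos_of_mul_pos_right (two_pos.trans_le (two_le_mul_deltaMax β)) (by positivity)

lemma extendedNode_lt_succ (hβ : StrictMono β) (hβΩ : ∀ n, β n ∈ Omega) {n : ℕ} (hn : n ≤ N) :
    extendedNode β n < extendedNode β (n + 1) := by
  rcases n with _ | m
  · rw [extendedNode_zero]
    by_cases hN : 0 < N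
    · exact (hβΩ ⟨0, hN⟩).1.trans_eq (extendedNode_val_add_one β ⟨0, hN⟩).symm
    · rw [extendedNode_of_lt β (by omega)]
      norm_num
  · rw [extendedNode_val_add_one β ⟨m, by omega⟩]
    by_cases hm : m + 1 < N
    · rw [extendedNode_val_add_one β ⟨m + 1, hm⟩]
      exact hβ (Nat.lt_succ_self m)
    · rw [extendedNode_of_lt β (by omega)]
      exact (hβΩ _).2

lemma extendedNode_monotone (hβ : StrictMono β) (hβΩ : ∀ n, β n ∈ Omega) :
    Monotone (extendedNode β) := by
  refine monotone_nat_of_le_succ fun n => ?_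
  rcases le_or_gt n N with h | h
  · exact (extendedNode_lt_succ hβ hβΩ h).le
  · rw [extendedNode_of_lt β h, extendedNode_of_lt β (by omega)]

namespace IsQuasiUniform

lemma deltaMin_pos (hβ : IsQuasiUniform B β) : 0 < deltaMin β := by
  have hN := hβ.two_le
  have : Nonempty (Fin (N - 1)) := ⟨⟨0, by omega⟩⟩
  obtain ⟨i, hi⟩ := exists_eq_ciInf_of_finite
    (f := fun n : Fin (N - 1) => extendedNode β (n + 2) - extendedNode β (n + 1))
  rw [deltaMin, ← hi]
  exact sub_pos.2 (extendedNode_lt_succ hβ.strictMono hβ.mem_Omega (by omega))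

lemma deltaMax_le_mul (hβ : IsQuasiUniform B β) : deltaMax β ≤ B * deltaMin β :=
  (div_le_iff₀ hβ.deltaMin_pos).1 hβ.ratio_le

lemma pos (hβ : IsQuasiUniform B β) : 0 < B :=
  (div_pos (deltaMax_pos β) hβ.deltaMin_pos).trans_le hβ.ratio_le

lemma cast_two_le (hβ : IsQuasiUniform B β) : (2 : ℝ) ≤ N := by exact_mod_cast hβ.two_le

lemma sub_one_mul_deltaMin_le (hβ : IsQuasiUniform B β) : ((N : ℝ) - 1) * deltaMin β ≤ 2 := by
  have hN := hβ.two_le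
  have hmono := extendedNode_monotone hβ.strictMono hβ.mem_Omega
  have hfirst := hmono (zero_le_one : 0 ≤ 1)
  have hlast := hmono (show N - 1 + 1 ≤ N + 1 by omega)
  have hsum := mul_deltaMin_le_extendedNode_sub (β := β) (show N - 1 < N by omega)
  rw [extendedNode_zero] at hfirst
  rw [extendedNode_of_lt β (Nat.lt_succ_self N)] at hlast
  push_cast [Nat.cast_sub (one_le_two.trans hN)] at hsum
  linarith

lemma deltaMax_le (hβ : IsQuasiUniform B β) : deltaMax β ≤ 4 * B / N := by
  have hN := hβ.cast_two_le
  have hmin : deltaMin β * N ≤ 4 := by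
    nlinarith [hβ.sub_one_mul_deltaMin_le, hβ.deltaMin_pos]
  rw [le_div_iff₀ (by linarith)]
  calc deltaMax β * N ≤ B * deltaMin β * N := by gcongr; exact hβ.deltaMax_le_mul
    _ = B * (deltaMin β * N) := mul_assoc _ _ _
    _ ≤ B * 4 := by gcongr; exact hβ.pos.le
    _ = 4 * B := mul_comm _ _

lemma one_div_le_deltaMin (hβ : IsQuasiUniform B β) : 1 / (B * N) ≤ deltaMin β := by
  have hN := hβ.cast_two_le
  have hmax : 1 ≤ N * deltaMax β := by
    nlinarith [two_le_mul_deltaMax β, deltaMax_pos β]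
  rw [div_le_iff₀ (mul_pos hβ.pos (by linarith))]
  calc 1 ≤ N * deltaMax β := hmax
    _ ≤ N * (B * deltaMin β) := by gcongr; exact hβ.deltaMax_le_mul
    _ = deltaMin β * (B * N) := by ring

lemma one_div_le_sub (hβ : IsQuasiUniform B β) {v w : Fin N} (hvw : v < w) :
    1 / (B * N) ≤ β w - β v := by
  have hgap := deltaMin_le (β := β) (n := v) (by omega)
  have hmono := extendedNode_monotone hβ.strictMono hβ.mem_Omega (show (v : ℕ) + 2 ≤ w + 1 by omega)
  rw [extendedNode_val_add_one] at hgap hmono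
  linarith [hβ.one_div_le_deltaMin]

end IsQuasiUniform

lemma exists_extendedNode_le_lt (β : Fin N → ℝ) {z : ℝ} (hz : z ∈ Omega) :
    ∃ m ≤ N, extendedNode β m ≤ z ∧ z < extendedNode β (m + 1) := by
  classical
  have hzero : extendedNode β 0 ≤ z := (extendedNode_zero β).trans_le hz.1.le
  refine ⟨Nat.findGreatest (extendedNode β · ≤ z) N, Nat.findGreatest_le _,
    Nat.findGreatest_spec (P := (extendedNode β · ≤ z)) (Nat.zero_le N) hzero, ?_⟩
  rcases (Nat.findGreatest_le (P := (extendedNode β · ≤ z)) N).lt_or_eq with h | h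
  · exact not_le.1 (Nat.findGreatest_is_greatest (Nat.lt_succ_self _) h)
  · rw [h, extendedNode_of_lt β (Nat.lt_succ_self N)]
    exact hz.2

lemma HasNeighbours.mono {F : Finset (Fin N)} {d d' z : ℝ} (h : HasNeighbours β F d z)
    (hd : d ≤ d') : HasNeighbours β F d' z := by
  obtain ⟨⟨v, hv, hvz⟩, w, hw, hwz⟩ := h
  exact ⟨⟨v, hv, by linarith [hvz.1], hvz.2⟩, w, hw, hwz.1, by linarith [hwz.2]⟩

lemma extendedNode_sub_le_mul (β : Fin N → ℝ) {i j L : ℕ} (hij : i ≤ j) (hjL : j ≤ i + L)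
    (hj : j ≤ N + 1) : extendedNode β j - extendedNode β i ≤ L * deltaMax β := by
  obtain ⟨k, rfl⟩ := Nat.exists_eq_add_of_le hij
  refine (extendedNode_add_sub_le β hj).trans ?_
  gcongr
  · exact (deltaMax_pos β).le
  · omega

lemma le_of_extendedNode_lt {L m : ℕ} {z : ℝ} (hmN : m ≤ N) (hzm : z < extendedNode β (m + 1))
    (hz : (L + 1) * deltaMax β ≤ 1 + z) : L ≤ m := by
  have h := extendedNode_add_sub_le β (n := 0) (k := m + 1) (by omega)
  rw [extendedNode_zero, zero_add] at h
  have : ((L + 1 : ℕ) : ℝ) < (m + 1 : ℕ) :=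
    lt_of_mul_lt_mul_right (by push_cast at h ⊢; linarith) (deltaMax_pos β).le
  exact (Nat.lt_of_succ_lt_succ (Nat.cast_lt.1 this)).le

lemma add_le_of_extendedNode_le {L m : ℕ} {z : ℝ} (hmN : m ≤ N) (hmz : extendedNode β m ≤ z)
    (hz : (L + 1) * deltaMax β ≤ 1 - z) : m + L ≤ N := by
  have h := extendedNode_add_sub_le β (n := m) (k := N + 1 - m) (by omega)
  rw [Nat.add_sub_cancel' (by omega), extendedNode_of_lt β (Nat.lt_succ_self N)] at h
  have : ((L + 1 : ℕ) : ℝ) ≤ (N + 1 - m : ℕ) :=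
    le_of_mul_le_mul_right (by push_cast at h ⊢; linarith) (deltaMax_pos β)
  have := Nat.cast_le.1 this
  omega

lemma HitsWindows.hasNeighbours (hβ : StrictMono β) (hβΩ : ∀ n, β n ∈ Omega) {L : ℕ}
    {F : Finset (Fin N)} (hF : HitsWindows L F) {z : ℝ} (hz : z ∈ Omega)
    (hleft : (L + 1) * deltaMax β ≤ 1 + z) (hright : (L + 1) * deltaMax β ≤ 1 - z) :
    HasNeighbours β F (L * deltaMax β) z := by
  obtain ⟨m, hmN, hmz, hzm⟩ := exists_extendedNode_le_lt β hz
  have hmono := extendedNode_monotone hβ hβΩ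
  have hLm : L ≤ m := le_of_extendedNode_lt hmN hzm hleft
  have hmL : m + L ≤ N := add_le_of_extendedNode_le hmN hmz hright
  constructor
  · obtain ⟨v, hvF, hv, hvm⟩ := hF (m - L) (by omega)
    have hvz := hmono (show (v : ℕ) + 1 ≤ m by omega)
    have hd := extendedNode_sub_le_mul β (L := L) (i := v + 1) (j := m + 1) (by omega) (by omega)
      (by omega)
    rw [extendedNode_val_add_one] at hvz hd
    exact ⟨v, hvF, by linarith, hvz.trans hmz⟩
  · obtain ⟨w, hwF, hw, hwm⟩ := hF m hmL
    have hzw := hmono (show m + 1 ≤ (w : ℕ) + 1 by omega)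
    have hd := extendedNode_sub_le_mul β (L := L) (i := m) (j := w + 1) (by omega) (by omega)
      (by omega)
    rw [extendedNode_val_add_one] at hzw hd
    exact ⟨w, hwF, hzm.trans_le hzw, by linarith⟩

lemma HitsWindows.hasNeighbours_of_isQuasiUniform {p : ℝ} (hβ : IsQuasiUniform B β)
    (hlog : 1 ≤ Real.logb (1 / p) N) {F : Finset (Fin N)} (hF : HitsWindows (windowLength p N) F)
    {z : ℝ} (hz : 32 * B * (Real.logb (1 / p) N / N) ≤ 1 - |z|) :
    HasNeighbours β F (28 * B * (Real.logb (1 / p) N / N)) z := by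
  have hL := windowLength_le hlog
  have hmul {c : ℝ} (hc : 0 ≤ c) :
      c * Real.logb (1 / p) N * deltaMax β ≤ 4 * c * B * (Real.logb (1 / p) N / N) :=
    (mul_le_mul_of_nonneg_left hβ.deltaMax_le (by positivity)).trans_eq (by ring)
  have hmax := (deltaMax_pos β).le
  have hwide : (windowLength p N + 1) * deltaMax β ≤ 1 - |z| :=
    (mul_le_mul_of_nonneg_right (by linarith) hmax).trans
      ((hmul (c := 8) (by norm_num)).trans (by linarith))
  have hzabs : |z| < 1 := by
    have : 0 < (windowLength p N + 1) * deltaMax β := mul_pos (by positivity) (deltaMax_pos β)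
    linarith
  refine (hF.hasNeighbours hβ.strictMono hβ.mem_Omega (abs_lt.1 hzabs)
    (by linarith [neg_abs_le z]) (by linarith [le_abs_self z])).mono ?_
  exact (mul_le_mul_of_nonneg_right hL hmax).trans
    ((hmul (c := 7) (by norm_num)).trans (by linarith))

end Nodes

section ApproxError

variable {p : ℝ} {K : ℕ} {x α : Fin K → ℝ} {β : (N : ℕ) → Fin N → ℝ} {B : ℝ}
  {f : ℝ → ℝ} {dec : (N : ℕ) → Finset (Fin N) → ℝ → ℝ}

lemma eventually_probability_not_hasNeighbours_le (hp0 : 0 < p) (hp1 : p < 1)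
    (hα : ∀ k, α k ∈ Omega) (hβ : ∀ᶠ N in atTop, IsQuasiUniform B (β N)) :
    ∀ᶠ N in atTop, probability p
      {F | ∀ k, HasNeighbours (β N) F (28 * B * (Real.logb (1 / p) N / N)) (α k)}ᶜ ≤
        1 / (N : ℝ) ^ 5 := by
  have hsmall (k : Fin K) : ∀ᶠ N : ℕ in atTop,
      32 * B * (Real.logb (1 / p) N / N) ≤ 1 - |α k| := by
    have h := (tendsto_logb_pow_div_pow p 1 one_ne_zero).const_mul (32 * B)
    simp only [pow_one, mul_zero] at h
    exact h.eventually_le_const (sub_pos.2 (abs_lt.2 (hα k)))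
  filter_upwards [hβ, (tendsto_logb_natCast hp0 hp1).eventually_ge_atTop 1,
    eventually_all.2 hsmall] with N hβN hlog hN
  refine (probability_mono hp0.le hp1.le ?_).trans
    (probability_not_hitsWindows_windowLength_le hp0 hp1 hlog)
  exact Set.compl_subset_compl.2 fun F hF k => hF.hasNeighbours_of_isQuasiUniform hβN hlog (hN k)

lemma approxError_nonneg (α x : Fin K → ℝ) (f u : ℝ → ℝ) : 0 ≤ approxError α x f u := by
  rw [approxError]
  positivity

lemma approxError_le (hK : 0 < K) {u : ℝ → ℝ} {c : ℝ} (h : ∀ k, (u (α k) - f (x k)) ^ 2 ≤ c) :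
    approxError α x f u ≤ c := by
  have hsum : ∑ k, (u (α k) - f (x k)) ^ 2 ≤ K * c := by
    simpa using Finset.sum_le_card_nsmul Finset.univ _ c fun k _ => h k
  calc approxError α x f u ≤ 1 / K * (K * c) := mul_le_mul_of_nonneg_left hsum (by positivity)
    _ = c := by field_simp

lemma one_div_pow_isBigO_logb_pow_div_pow (hp0 : 0 < p) (hp1 : p < 1) (a : ℕ) {b c : ℕ}
    (hbc : b ≤ c) : (fun N : ℕ => 1 / (N : ℝ) ^ c) =O[atTop]
      fun N => Real.logb (1 / p) N ^ a / (N : ℝ) ^ b := by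
  refine .of_norm_eventuallyLE ?_
  filter_upwards [(tendsto_logb_natCast hp0 hp1).eventually_ge_atTop 1,
    eventually_ge_atTop 1] with N hlog hN
  have hN' : (1 : ℝ) ≤ N := by exact_mod_cast hN
  rw [Real.norm_of_nonneg (by positivity)]
  gcongr
  exact one_le_pow₀ hlog

lemma convergesWithHighProbability_approxError (hp0 : 0 < p) (hp1 : p < 1) (hK : 0 < K)
    (hα : ∀ k, α k ∈ Omega) (hβ : ∀ᶠ N in atTop, IsQuasiUniform B (β N)) {a b : ℕ} (hb : b ≠ 0)
    {C : ℝ} (hnear : ∀ᶠ N in atTop, ∀ F k,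
      HasNeighbours (β N) F (28 * B * (Real.logb (1 / p) N / N)) (α k) →
        (dec N F (α k) - f (x k)) ^ 2 ≤ C * (Real.logb (1 / p) N ^ a / (N : ℝ) ^ b)) :
    ConvergesWithHighProbability p (fun N F => approxError α x f (dec N F))
      (fun N => Real.logb (1 / p) N ^ a / (N : ℝ) ^ b) := by
  refine convergesWithHighProbability_of_eventually_le hp0.le hp1.le
    (squeeze_zero' (.of_forall fun N => ?_)
      (eventually_probability_not_hasNeighbours_le hp0 hp1 hα hβ) ?_)
    (tendsto_logb_pow_div_pow p a hb)
    (hnear.mono fun N h F hF => approxError_le hK fun k => h F k (hF k))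
  · exact probability_nonneg hp0.le hp1.le _
  · simpa using tendsto_logb_pow_div_pow p 0 (b := 5) (by norm_num)

lemma convergesInMean_approxError (hp0 : 0 < p) (hp1 : p < 1) (hK : 0 < K)
    (hα : ∀ k, α k ∈ Omega) (hβ : ∀ᶠ N in atTop, IsQuasiUniform B (β N)) {a b : ℕ} (hb : b ≠ 0)
    (hb3 : b ≤ 3) {C D : ℝ} (hnear : ∀ᶠ N in atTop, ∀ F k,
      HasNeighbours (β N) F (28 * B * (Real.logb (1 / p) N / N)) (α k) →
        (dec N F (α k) - f (x k)) ^ 2 ≤ C * (Real.logb (1 / p) N ^ a / (N : ℝ) ^ b))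
    (hfar : ∀ᶠ N in atTop, ∀ F k, (dec N F (α k) - f (x k)) ^ 2 ≤ D * (N : ℝ) ^ 2) :
    ConvergesInMean p (fun N F => approxError α x f (dec N F))
      (fun N => Real.logb (1 / p) N ^ a / (N : ℝ) ^ b) := by
  refine convergesInMean_of_eventually_le hp0.le hp1.le
    (good := fun N => {F | ∀ k,
      HasNeighbours (β N) F (28 * B * (Real.logb (1 / p) N / N)) (α k)})
    (.trans ?_ (one_div_pow_isBigO_logb_pow_div_pow hp0 hp1 a hb3))
    (tendsto_logb_pow_div_pow p a hb) (fun N F => approxError_nonneg α x f _)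
    (hnear.mono fun N h F hF => approxError_le hK fun k => h F k (hF k))
    (hfar.mono fun N h F => approxError_le hK (h F))
  refine .of_bound |D| ?_
  filter_upwards [eventually_probability_not_hasNeighbours_le hp0 hp1 hα hβ] with N hprob
  rw [norm_mul, norm_mul, Real.norm_eq_abs D, Real.norm_of_nonneg (by positivity),
    Real.norm_of_nonneg (probability_nonneg hp0.le hp1.le _), Real.norm_of_nonneg (by positivity)]
  calc |D| * (N : ℝ) ^ 2 * _ ≤ |D| * (N : ℝ) ^ 2 * (1 / (N : ℝ) ^ 5) := by gcongr
    _ = |D| * (1 / (N : ℝ) ^ 3) := by field_simp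

end ApproxError

/-! ### Sobolev functions -/

section Sobolev

variable {u g : ℝ → ℝ}

lemma roughness_nonneg (u : ℝ → ℝ) : 0 ≤ roughness u :=
  integral_nonneg fun _ => sq_nonneg _

lemma MemH2.differentiableAt (hu : MemH2 u) {t : ℝ} (ht : t ∈ Omega) : DifferentiableAt ℝ u t :=
  hu.differentiableOn.differentiableAt (isOpen_Ioo.mem_nhds ht)

lemma sq_intervalIntegral_le {φ : ℝ → ℝ} {a b : ℝ} (hab : a ≤ b)
    (hφ : IntervalIntegrable φ volume a b)
    (hφ2 : IntervalIntegrable (fun t => φ t ^ 2) volume a b) :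
    (∫ t in a..b, φ t) ^ 2 ≤ (b - a) * ∫ t in a..b, φ t ^ 2 := by
  rcases hab.eq_or_lt with rfl | hab
  · simp
  set I := ∫ t in a..b, φ t
  have hexpand : ∫ t in a..b, ((b - a) * φ t - I) ^ 2 =
      (b - a) * ((b - a) * (∫ t in a..b, φ t ^ 2) - I ^ 2) := by
    have (t : ℝ) : ((b - a) * φ t - I) ^ 2 =
        (b - a) ^ 2 * φ t ^ 2 - 2 * (b - a) * I * φ t + I ^ 2 := by ring
    simp only [this]
    rw [intervalIntegral.integral_add ((hφ2.const_mul _).sub (hφ.const_mul _)) (by simp),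
      intervalIntegral.integral_sub (hφ2.const_mul _) (hφ.const_mul _),
      intervalIntegral.integral_const_mul, intervalIntegral.integral_const_mul,
      intervalIntegral.integral_const, smul_eq_mul]
    ring
  have hnonneg : 0 ≤ ∫ t in a..b, ((b - a) * φ t - I) ^ 2 :=
    intervalIntegral.integral_nonneg hab.le fun _ _ => sq_nonneg _
  rw [hexpand] at hnonneg
  exact sub_nonneg.1 (nonneg_of_mul_nonneg_right hnonneg (sub_pos.2 hab))

lemma MemH2.sq_deriv_sub_le (hu : MemH2 u) {s t : ℝ} (hs : s ∈ Omega) (ht : t ∈ Omega) :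
    (deriv u t - deriv u s) ^ 2 ≤ |t - s| * roughness u := by
  wlog hst : s ≤ t generalizing s t
  · rw [abs_sub_comm, ← neg_sub, neg_sq]
    exact this ht hs (le_of_not_ge hst)
  have hac := hu.absolutelyContinuous s hs t ht
  have hsub : Set.Ioc s t ⊆ Omega := fun x hx => ⟨hs.1.trans hx.1, hx.2.trans_lt ht.2⟩
  have hsq : IntegrableOn (fun x => deriv (deriv u) x ^ 2) Omega := hu.memLp.integrable_sq
  calc (deriv u t - deriv u s) ^ 2 = (∫ x in s..t, deriv (deriv u) x) ^ 2 := by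
        rw [hac.integral_deriv_eq_sub]
    _ ≤ (t - s) * ∫ x in s..t, deriv (deriv u) x ^ 2 :=
        sq_intervalIntegral_le hst hac.intervalIntegrable_deriv
          ((intervalIntegrable_iff_integrableOn_Ioc_of_le hst).2 (hsq.mono_set hsub))
    _ ≤ (t - s) * roughness u := by
        refine mul_le_mul_of_nonneg_left ?_ (sub_nonneg.2 hst)
        rw [intervalIntegral.integral_of_le hst]
        exact setIntegral_mono_set hsq (.of_forall fun _ => sq_nonneg _) (.of_forall hsub)
    _ = |t - s| * roughness u := by rw [abs_of_nonneg (sub_nonneg.2 hst)]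

lemma memH2_of_lipschitzOnWith_deriv {M : NNReal} (hg : DifferentiableOn ℝ g Omega)
    (hg' : LipschitzOnWith M (deriv g) Omega) : MemH2 g where
  differentiableOn := hg
  absolutelyContinuous a ha b hb :=
    LipschitzOnWith.absolutelyContinuousOnInterval
      (hg'.mono (Set.OrdConnected.uIcc_subset Set.ordConnected_Ioo ha hb))
  memLp := by
    have : IsFiniteMeasure (volume.restrict Omega) := ⟨by simp [Omega]⟩
    refine MemLp.of_bound (stronglyMeasurable_deriv _).aestronglyMeasurable M ?_
    refine (ae_restrict_mem measurableSet_Ioo).mono fun t ht => ?_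
    exact norm_deriv_le_of_lipschitzOn (isOpen_Ioo.mem_nhds ht) hg'

lemma locallyLipschitz_mul {φ ψ : ℝ → ℝ} (hφ : LocallyLipschitz φ) (hψ : LocallyLipschitz ψ) :
    LocallyLipschitz fun t => φ t * ψ t :=
  (contDiff_mul (𝕜 := ℝ) (n := 1)).locallyLipschitz.comp (hφ.prodMk hψ)

lemma memH2_comp {f e : ℝ → ℝ} (hf : Differentiable ℝ f) (hf' : LocallyLipschitz (deriv f))
    (he : ContDiff ℝ 2 e) : MemH2 (f ∘ e) := by
  have hd : Differentiable ℝ e := he.differentiable two_ne_zero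
  have he' : ContDiff ℝ 1 (deriv e) := ContDiff.deriv' (n := 1) he
  have hderiv : deriv (f ∘ e) = fun t => deriv f (e t) * deriv e t :=
    funext fun t => deriv_comp t (hf _) (hd t)
  have hlip : LocallyLipschitz (deriv (f ∘ e)) := hderiv ▸
    locallyLipschitz_mul (hf'.comp (he.of_le one_le_two).locallyLipschitz) he'.locallyLipschitz
  obtain ⟨M, hM⟩ := hlip.locallyLipschitzOn.exists_lipschitzOnWith_of_compact
    (isCompact_Icc (a := -1) (b := (1 : ℝ)))
  exact memH2_of_lipschitzOnWith_deriv (hf.comp hd).differentiableOn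
    (hM.mono Set.Ioo_subset_Icc_self)

end Sobolev

section Interpolation

variable {h : ℝ → ℝ} {S : Set ℝ}

lemma exists_mem_sub_eq_deriv_mul (hS : Convex ℝ S) (hd : ∀ s ∈ S, DifferentiableAt ℝ h s)
    {a z : ℝ} (ha : a ∈ S) (hz : z ∈ S) : ∃ c ∈ S, h z - h a = deriv h c * (z - a) := by
  obtain ⟨c, hc, heq⟩ := domain_mvt
    (fun s hs => (hd s hs).hasDerivAt.hasDerivWithinAt.hasFDerivWithinAt) hS ha hz
  exact ⟨c, hS.segment_subset ha hz hc, by simpa [mul_comm] using heq⟩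

lemma sq_le_of_sq_deriv_sub_le (hS : Convex ℝ S) (hd : ∀ s ∈ S, DifferentiableAt ℝ h s) {W : ℝ}
    (hW : ∀ s ∈ S, ∀ t ∈ S, (deriv h t - deriv h s) ^ 2 ≤ W) {a b z E : ℝ} (ha : a ∈ S)
    (hb : b ∈ S) (hz : z ∈ S) (hab : a ≠ b) (hEa : h a ^ 2 ≤ E) (hEb : h b ^ 2 ≤ E) :
    h z ^ 2 ≤ 4 * (1 + 4 * ((z - a) / (b - a)) ^ 2) * E + 2 * (z - a) ^ 2 * W := by
  obtain ⟨c, hc, hzc⟩ := exists_mem_sub_eq_deriv_mul hS hd ha hz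
  obtain ⟨e, he, hbe⟩ := exists_mem_sub_eq_deriv_mul hS hd ha hb
  set θ := (z - a) / (b - a)
  have hdecomp : h z = (h a + θ * (h b - h a)) + (deriv h c - deriv h e) * (z - a) := by
    have hθ : θ * (b - a) = z - a := div_mul_cancel₀ _ (sub_ne_zero.2 hab.symm)
    rw [hbe, ← hθ]
    rw [← hθ] at hzc
    linarith
  have hdiff : (h b - h a) ^ 2 ≤ 4 * E := by nlinarith [sq_nonneg (h b + h a)]
  have hlinear : (h a + θ * (h b - h a)) ^ 2 ≤ 2 * (1 + 4 * θ ^ 2) * E := by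
    calc (h a + θ * (h b - h a)) ^ 2 ≤ 2 * h a ^ 2 + 2 * (θ ^ 2 * (h b - h a) ^ 2) := by
          nlinarith [sq_nonneg (h a - θ * (h b - h a))]
      _ ≤ 2 * E + 2 * (θ ^ 2 * (4 * E)) := by gcongr
      _ = 2 * (1 + 4 * θ ^ 2) * E := by ring
  calc h z ^ 2
      ≤ 2 * (h a + θ * (h b - h a)) ^ 2 + 2 * ((z - a) ^ 2 * (deriv h c - deriv h e) ^ 2) := by
        rw [hdecomp]
        nlinarith [sq_nonneg ((h a + θ * (h b - h a)) - (deriv h c - deriv h e) * (z - a))]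
    _ ≤ 2 * (2 * (1 + 4 * θ ^ 2) * E) + 2 * ((z - a) ^ 2 * W) := by
        gcongr
        exact hW e he c hc
    _ = 4 * (1 + 4 * θ ^ 2) * E + 2 * (z - a) ^ 2 * W := by ring

end Interpolation

/-! ### The LeTCC decoder -/

lemma letccObjective_comp (f enc : ℝ → ℝ) {N : ℕ} (β : Fin N → ℝ) (lam : ℝ) (F : Finset (Fin N)) :
    letccObjective f enc β lam F (f ∘ enc) = lam * roughness (f ∘ enc) := by
  simp [letccObjective]

namespace IsLetccDecoder

variable {f enc : ℝ → ℝ} {N : ℕ} {β : Fin N → ℝ} {lam : ℝ} {F : Finset (Fin N)} {u : ℝ → ℝ}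

lemma roughness_le (hu : IsLetccDecoder f enc β lam F u) (hlam : 0 ≤ lam)
    (hg : MemH2 (f ∘ enc)) : roughness u ≤ roughness (f ∘ enc) := by
  have hfit (w : ℝ → ℝ) : 0 ≤ 1 / (F.card : ℝ) * ∑ v ∈ F, (w (β v) - f (enc (β v))) ^ 2 := by
    positivity
  rcases hlam.eq_or_lt with rfl | hpos
  · refine hu.2 rfl _ ⟨hg, fun w _ => ?_⟩
    rw [letccObjective_comp, letccObjective, zero_mul, zero_mul, add_zero]
    exact hfit w
  · have hmin := hu.1.2 _ hg
    rw [letccObjective_comp, letccObjective] at hmin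
    exact le_of_mul_le_mul_left (by linarith [hfit u]) hpos

lemma sq_residual_le (hu : IsLetccDecoder f enc β lam F u) (hlam : 0 ≤ lam)
    (hlam' : lam ≤ 1 / (N : ℝ) ^ 4) (hg : MemH2 (f ∘ enc)) {v : Fin N} (hv : v ∈ F) :
    (u (β v) - f (enc (β v))) ^ 2 ≤ roughness (f ∘ enc) / (N : ℝ) ^ 3 := by
  have hF : (0 : ℝ) < F.card := Nat.cast_pos.2 (Finset.card_pos.2 ⟨v, hv⟩)
  have hFN : (F.card : ℝ) ≤ N := Nat.cast_le.2 (F.card_le_univ.trans_eq (Fintype.card_fin N))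
  have hN : (0 : ℝ) < N := hF.trans_le hFN
  have hR := roughness_nonneg (f ∘ enc)
  have hmin : 1 / (F.card : ℝ) * ∑ v ∈ F, (u (β v) - f (enc (β v))) ^ 2 ≤
      lam * roughness (f ∘ enc) := by
    have h := hu.1.2 _ hg
    rw [letccObjective_comp, letccObjective] at h
    linarith [mul_nonneg hlam (roughness_nonneg u)]
  calc (u (β v) - f (enc (β v))) ^ 2 ≤ ∑ v ∈ F, (u (β v) - f (enc (β v))) ^ 2 :=
        Finset.single_le_sum (f := fun v => (u (β v) - f (enc (β v))) ^ 2)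
          (fun _ _ => sq_nonneg _) hv
    _ ≤ F.card * (lam * roughness (f ∘ enc)) := by rwa [one_div, inv_mul_le_iff₀ hF] at hmin
    _ ≤ N * (1 / (N : ℝ) ^ 4 * roughness (f ∘ enc)) := by gcongr
    _ = roughness (f ∘ enc) / (N : ℝ) ^ 3 := by field_simp

lemma sq_deriv_error_sub_le (hu : IsLetccDecoder f enc β lam F u) (hlam : 0 ≤ lam)
    (hg : MemH2 (f ∘ enc)) {s t : ℝ} (hs : s ∈ Omega) (ht : t ∈ Omega) :
    (deriv (u - f ∘ enc) t - deriv (u - f ∘ enc) s) ^ 2 ≤ 4 * |t - s| * roughness (f ∘ enc) := by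
  rw [deriv_sub (hu.1.1.differentiableAt ht) (hg.differentiableAt ht),
    deriv_sub (hu.1.1.differentiableAt hs) (hg.differentiableAt hs)]
  have hdec := (hu.1.1.sq_deriv_sub_le hs ht).trans
    (mul_le_mul_of_nonneg_left (hu.roughness_le hlam hg) (abs_nonneg _))
  have htarget := hg.sq_deriv_sub_le hs ht
  nlinarith [sq_nonneg ((deriv u t - deriv u s) + (deriv (f ∘ enc) t - deriv (f ∘ enc) s))]

lemma sq_error_le (hu : IsLetccDecoder f enc β lam F u) (hlam : 0 ≤ lam)
    (hlam' : lam ≤ 1 / (N : ℝ) ^ 4) (hg : MemH2 (f ∘ enc)) {S : Set ℝ} (hS : Convex ℝ S)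
    (hSΩ : S ⊆ Omega) {d : ℝ} (hd : ∀ s ∈ S, ∀ t ∈ S, |t - s| ≤ d) {v w : Fin N} (hv : v ∈ F)
    (hw : w ∈ F) (hvS : β v ∈ S) (hwS : β w ∈ S) (hvw : β v ≠ β w) {z : ℝ} (hz : z ∈ S) :
    (u z - f (enc z)) ^ 2 ≤
      4 * (1 + 4 * ((z - β v) / (β w - β v)) ^ 2) * (roughness (f ∘ enc) / (N : ℝ) ^ 3) +
        8 * (z - β v) ^ 2 * d * roughness (f ∘ enc) := by
  have hR := roughness_nonneg (f ∘ enc)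
  have hW : ∀ s ∈ S, ∀ t ∈ S, (deriv (u - f ∘ enc) t - deriv (u - f ∘ enc) s) ^ 2 ≤
      4 * d * roughness (f ∘ enc) := fun s hs t ht =>
    (hu.sq_deriv_error_sub_le hlam hg (hSΩ hs) (hSΩ ht)).trans (by gcongr; exact hd s hs t ht)
  refine (sq_le_of_sq_deriv_sub_le (h := u - f ∘ enc) hS
    (fun s hs => (hu.1.1.differentiableAt (hSΩ hs)).sub (hg.differentiableAt (hSΩ hs))) hW
    hvS hwS hz hvw (hu.sq_residual_le hlam hlam' hg hv)
    (hu.sq_residual_le hlam hlam' hg hw)).trans_eq ?_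
  ring

lemma sq_error_le_of_mem_Icc (hu : IsLetccDecoder f enc β lam F u) (hlam : 0 ≤ lam)
    (hlam' : lam ≤ 1 / (N : ℝ) ^ 4) (hg : MemH2 (f ∘ enc)) {v w : Fin N} (hv : v ∈ F) (hw : w ∈ F)
    (hvΩ : β v ∈ Omega) (hwΩ : β w ∈ Omega) (hvw : β v < β w) {z : ℝ}
    (hz : z ∈ Set.Icc (β v) (β w)) :
    (u z - f (enc z)) ^ 2 ≤ (20 / (N : ℝ) ^ 3 + 8 * (β w - β v) ^ 3) * roughness (f ∘ enc) := by
  have hR := roughness_nonneg (f ∘ enc)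
  have hpos : 0 < β w - β v := sub_pos.2 hvw
  have hz0 : 0 ≤ z - β v := sub_nonneg.2 hz.1
  have hzw : z - β v ≤ β w - β v := sub_le_sub_right hz.2 _
  have hθ : (z - β v) / (β w - β v) ≤ 1 := (div_le_one hpos).2 hzw
  refine (hu.sq_error_le hlam hlam' hg (convex_Icc _ _) (Set.ordConnected_Ioo.out hvΩ hwΩ)
    (fun s hs t ht => Real.dist_le_of_mem_Icc ht hs) hv hw (Set.left_mem_Icc.2 hvw.le)
    (Set.right_mem_Icc.2 hvw.le) hvw.ne hz).trans ?_
  calc _ ≤ 4 * (1 + 4 * 1 ^ 2) * (roughness (f ∘ enc) / (N : ℝ) ^ 3) +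
        8 * (β w - β v) ^ 2 * (β w - β v) * roughness (f ∘ enc) := by gcongr
    _ = (20 / (N : ℝ) ^ 3 + 8 * (β w - β v) ^ 3) * roughness (f ∘ enc) := by ring

lemma sq_error_le_of_mem_Omega (hu : IsLetccDecoder f enc β lam F u) (hlam : 0 ≤ lam)
    (hlam' : lam ≤ 1 / (N : ℝ) ^ 4) (hg : MemH2 (f ∘ enc)) {v w : Fin N} (hv : v ∈ F) (hw : w ∈ F)
    (hvΩ : β v ∈ Omega) (hwΩ : β w ∈ Omega) {δ : ℝ} (hδ : 0 < δ) (hvw : δ ≤ β w - β v) {z : ℝ}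
    (hz : z ∈ Omega) :
    (u z - f (enc z)) ^ 2 ≤
      (4 * (1 + 16 / δ ^ 2) / (N : ℝ) ^ 3 + 64) * roughness (f ∘ enc) := by
  have hR := roughness_nonneg (f ∘ enc)
  have hwidth : ∀ s ∈ Omega, ∀ t ∈ Omega, |t - s| ≤ 2 := fun s hs t ht =>
    (Real.dist_le_of_mem_Icc (Set.Ioo_subset_Icc_self ht) (Set.Ioo_subset_Icc_self hs)).trans_eq
      (by norm_num)
  have hz2 : (z - β v) ^ 2 ≤ 2 ^ 2 := sq_le_sq' (by linarith [abs_le.1 (hwidth _ hvΩ _ hz)])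
    (abs_le.1 (hwidth _ hvΩ _ hz)).2
  have hne : β v ≠ β w := (sub_pos.1 (hδ.trans_le hvw)).ne
  refine (hu.sq_error_le hlam hlam' hg (convex_Ioo _ _) subset_rfl hwidth hv hw hvΩ hwΩ hne
    hz).trans ?_
  rw [div_pow]
  calc _ ≤ 4 * (1 + 4 * (2 ^ 2 / δ ^ 2)) * (roughness (f ∘ enc) / (N : ℝ) ^ 3) +
        8 * 2 ^ 2 * 2 * roughness (f ∘ enc) := by gcongr
    _ = (4 * (1 + 16 / δ ^ 2) / (N : ℝ) ^ 3 + 64) * roughness (f ∘ enc) := by ring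

lemma sq_error_le_of_hasNeighbours (hu : IsLetccDecoder f enc β lam F u) (hlam : 0 ≤ lam)
    (hlam' : lam ≤ 1 / (N : ℝ) ^ 4) (hg : MemH2 (f ∘ enc)) (hβ : ∀ n, β n ∈ Omega) {d z : ℝ}
    (hz : HasNeighbours β F d z) :
    (u z - f (enc z)) ^ 2 ≤ (20 / (N : ℝ) ^ 3 + 64 * d ^ 3) * roughness (f ∘ enc) := by
  obtain ⟨⟨v, hv, hvd, hvz⟩, w, hw, hzw, hwd⟩ := hz
  have hR := roughness_nonneg (f ∘ enc)
  have hvw : β v < β w := hvz.trans_lt hzw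
  refine (hu.sq_error_le_of_mem_Icc hlam hlam' hg hv hw (hβ v) (hβ w) hvw ⟨hvz, hzw.le⟩).trans ?_
  have hwidth : (β w - β v) ^ 3 ≤ (2 * d) ^ 3 :=
    pow_le_pow_left₀ (sub_nonneg.2 hvw.le) (by linarith) 3
  exact mul_le_mul_of_nonneg_right (by linarith) hR

lemma sq_error_le_of_one_lt_card (hu : IsLetccDecoder f enc β lam F u) (hlam : 0 ≤ lam)
    (hlam' : lam ≤ 1 / (N : ℝ) ^ 4) (hg : MemH2 (f ∘ enc)) {B : ℝ} (hβ : IsQuasiUniform B β)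
    (hF : 1 < F.card) {z : ℝ} (hz : z ∈ Omega) :
    (u z - f (enc z)) ^ 2 ≤ (68 + 64 * B ^ 2) * roughness (f ∘ enc) * (N : ℝ) ^ 2 := by
  have hN : (1 : ℝ) ≤ N := one_le_two.trans hβ.cast_two_le
  have hB := hβ.pos
  have hR := roughness_nonneg (f ∘ enc)
  obtain ⟨v, w, hv, hw, hvw⟩ : ∃ v w, v ∈ F ∧ w ∈ F ∧ v < w := by
    obtain ⟨v, hv, w, hw, hne⟩ := Finset.one_lt_card.1 hF
    exact hne.lt_or_gt.elim (fun h => ⟨v, w, hv, hw, h⟩) fun h => ⟨w, v, hw, hv, h⟩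
  refine (hu.sq_error_le_of_mem_Omega hlam hlam' hg hv hw (hβ.mem_Omega v) (hβ.mem_Omega w)
    (by positivity) (hβ.one_div_le_sub hvw) hz).trans ?_
  have hcoeff : 4 * (1 + 16 / (1 / (B * N)) ^ 2) / (N : ℝ) ^ 3 + 64 ≤
      (68 + 64 * B ^ 2) * (N : ℝ) ^ 2 := by
    calc 4 * (1 + 16 / (1 / (B * N)) ^ 2) / (N : ℝ) ^ 3 + 64
        = 4 / (N : ℝ) ^ 3 + 64 * B ^ 2 / N + 64 := by field_simp; ring
      _ ≤ 4 + 64 * B ^ 2 + 64 := by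
        gcongr
        · exact div_le_self (by norm_num) (one_le_pow₀ hN)
        · exact div_le_self (by positivity) hN
      _ = (68 + 64 * B ^ 2) * 1 := by ring
      _ ≤ (68 + 64 * B ^ 2) * (N : ℝ) ^ 2 := by gcongr; exact one_le_pow₀ hN
  exact (mul_le_mul_of_nonneg_right hcoeff hR).trans_eq (by ring)

end IsLetccDecoder

section Letcc

variable {p : ℝ} {K : ℕ} {x α : Fin K → ℝ} {β : (N : ℕ) → Fin N → ℝ} {B : ℝ} {f enc : ℝ → ℝ}
  {lam : ℕ → ℝ} {dec : (N : ℕ) → Finset (Fin N) → ℝ → ℝ}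

lemma eventually_letcc_sq_error_le (hp0 : 0 < p) (hp1 : p < 1)
    (hβ : ∀ᶠ N in atTop, IsQuasiUniform B (β N)) (henc : ∀ k, enc (α k) = x k)
    (hg : MemH2 (f ∘ enc)) (hlam : ∀ N, 1 ≤ N → 0 ≤ lam N ∧ lam N ≤ 1 / (N : ℝ) ^ 4)
    (hdec : ∀ N F, F.Nonempty → IsLetccDecoder f enc (β N) (lam N) F (dec N F)) :
    ∀ᶠ N in atTop, ∀ F k, HasNeighbours (β N) F (28 * B * (Real.logb (1 / p) N / N)) (α k) →
      (dec N F (α k) - f (x k)) ^ 2 ≤ (20 + 64 * (28 * B) ^ 3) * roughness (f ∘ enc) *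
        (Real.logb (1 / p) N ^ 3 / (N : ℝ) ^ 3) := by
  filter_upwards [hβ, (tendsto_logb_natCast hp0 hp1).eventually_ge_atTop 1] with N hβN hlog F k hk
  obtain ⟨hlam0, hlam1⟩ := hlam N (one_le_two.trans hβN.two_le)
  obtain ⟨⟨v, hv, -⟩, -⟩ := id hk
  have hone : 1 / (N : ℝ) ^ 3 ≤ Real.logb (1 / p) N ^ 3 / (N : ℝ) ^ 3 := by
    gcongr
    exact one_le_pow₀ hlog
  rw [← henc k]
  refine ((hdec N F ⟨v, hv⟩).sq_error_le_of_hasNeighbours hlam0 hlam1 hg hβN.mem_Omega hk).trans ?_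
  calc (20 / (N : ℝ) ^ 3 + 64 * (28 * B * (Real.logb (1 / p) N / N)) ^ 3) * roughness (f ∘ enc)
      = (20 * (1 / (N : ℝ) ^ 3) +
          64 * (28 * B) ^ 3 * (Real.logb (1 / p) N ^ 3 / (N : ℝ) ^ 3)) * roughness (f ∘ enc) := by
        ring
    _ ≤ (20 * (Real.logb (1 / p) N ^ 3 / (N : ℝ) ^ 3) +
          64 * (28 * B) ^ 3 * (Real.logb (1 / p) N ^ 3 / (N : ℝ) ^ 3)) * roughness (f ∘ enc) := by
        gcongr
        exact roughness_nonneg _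
    _ = (20 + 64 * (28 * B) ^ 3) * roughness (f ∘ enc) *
          (Real.logb (1 / p) N ^ 3 / (N : ℝ) ^ 3) := by ring

lemma exists_eventually_letcc_sq_error_le (hα : ∀ k, α k ∈ Omega)
    (hβ : ∀ᶠ N in atTop, IsQuasiUniform B (β N)) (henc : ∀ k, enc (α k) = x k)
    (hg : MemH2 (f ∘ enc)) (hlam : ∀ N, 1 ≤ N → 0 ≤ lam N ∧ lam N ≤ 1 / (N : ℝ) ^ 4)
    (hdec : ∀ N F, F.Nonempty → IsLetccDecoder f enc (β N) (lam N) F (dec N F))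
    (hbdd : ∃ M : ℝ, ∀ N F, F.card < 2 → ∀ k, |dec N F (α k)| ≤ M) :
    ∃ D : ℝ, ∀ᶠ N in atTop, ∀ F k, (dec N F (α k) - f (x k)) ^ 2 ≤ D * (N : ℝ) ^ 2 := by
  obtain ⟨M, hM⟩ := hbdd
  set D₁ := (68 + 64 * B ^ 2) * roughness (f ∘ enc)
  set D₂ := 2 * M ^ 2 + 2 * ∑ k, f (x k) ^ 2
  have hD₁ : 0 ≤ D₁ := mul_nonneg (by positivity) (roughness_nonneg _)
  have hD₂ : 0 ≤ D₂ := by positivity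
  refine ⟨D₁ + D₂, hβ.mono fun N hβN F k => ?_⟩
  have hN : (1 : ℝ) ≤ (N : ℝ) ^ 2 := one_le_pow₀ (one_le_two.trans hβN.cast_two_le)
  rcases lt_or_ge F.card 2 with hF | hF
  · have hfk : f (x k) ^ 2 ≤ ∑ k, f (x k) ^ 2 :=
      Finset.single_le_sum (f := fun k => f (x k) ^ 2) (fun _ _ => sq_nonneg _) (Finset.mem_univ k)
    have hdk : dec N F (α k) ^ 2 ≤ M ^ 2 := sq_le_sq.2 ((hM N F hF k).trans (le_abs_self M))
    have hsmall : (dec N F (α k) - f (x k)) ^ 2 ≤ D₂ := by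
      nlinarith [sq_nonneg (dec N F (α k) + f (x k))]
    nlinarith
  · obtain ⟨hlam0, hlam1⟩ := hlam N (one_le_two.trans hβN.two_le)
    have hlarge := (hdec N F (Finset.card_pos.1 (two_pos.trans_le hF))).sq_error_le_of_one_lt_card
      hlam0 hlam1 hg hβN hF (hα k)
    rw [← henc k]
    nlinarith

end Letcc

/-! ### Alternating sums -/

section AlternatingSum

lemma alternatingSign_insert_self {n : ℕ} {F : Finset (Fin n)} {a : Fin n} (ha : ∀ v ∈ F, a < v) :
    alternatingSign (insert a F) a = 1 := by
  have hnone : (insert a F).filter (· < a) = ∅ := by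
    simpa [Finset.filter_eq_empty_iff] using fun v hv => (ha v hv).le
  rw [alternatingSign, hnone, Finset.card_empty, pow_zero]

lemma alternatingSign_insert_of_mem {n : ℕ} {F : Finset (Fin n)} {a v : Fin n}
    (ha : ∀ v ∈ F, a < v) (hv : v ∈ F) :
    alternatingSign (insert a F) v = -alternatingSign F v := by
  have hmem : a ∉ F.filter (· < v) := fun h => (ha a (Finset.mem_filter.1 h).1).false
  rw [alternatingSign, Finset.filter_insert, if_pos (ha v hv), Finset.card_insert_of_notMem hmem,
    pow_succ, mul_neg_one, alternatingSign]

lemma sum_alternatingSign_mul {n : ℕ} (F : Finset (Fin n)) (φ : Fin n → ℝ) :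
    ∑ v ∈ F, alternatingSign F v * φ v = (F.sort.map φ).alternatingSum := by
  induction F using Finset.induction_on_min with
  | empty => simp
  | insert a F ha ih =>
    have haF : a ∉ F := fun h => (ha a h).false
    have htail : ∑ v ∈ F, alternatingSign (insert a F) v * φ v =
        -∑ v ∈ F, alternatingSign F v * φ v := by
      rw [← Finset.sum_neg_distrib]
      exact Finset.sum_congr rfl fun v hv => by rw [alternatingSign_insert_of_mem ha hv, neg_mul]
    rw [Finset.sum_insert haF, htail, ih, alternatingSign_insert_self ha,
      Finset.sort_insert _ (fun v hv => (ha v hv).le) haF, List.map_cons, List.alternatingSum_cons,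
      one_mul, sub_eq_add_neg]

lemma abs_alternatingSum_map_le {ι : Type*} {φ V : ι → ℝ} {M m T : ℝ} (hM : 0 ≤ M) :
    ∀ {l : List ι}, m ≤ T → l.Pairwise (fun a b => |φ a - φ b| ≤ V b - V a) →
      (∀ a ∈ l, |φ a| ≤ M) → (∀ a ∈ l, V a ∈ Set.Icc m T) →
      |(l.map φ).alternatingSum| ≤ M + (T - m)
  | [], hmT, _, _, _ => by simpa using add_nonneg hM (sub_nonneg.2 hmT)
  | [a], hmT, _, hφ, _ => by
    simpa using (hφ a (by simp)).trans (le_add_of_nonneg_right (sub_nonneg.2 hmT))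
  | a :: b :: l, _, hl, hφ, hV => by
    simp only [List.pairwise_cons, List.mem_cons, forall_eq_or_imp] at hl hφ hV
    obtain ⟨⟨hab, -⟩, hbl, hl⟩ := hl
    have htail : |(l.map φ).alternatingSum| ≤ M + (T - V b) :=
      abs_alternatingSum_map_le hM hV.2.1.2 hl hφ.2.2 fun c hc =>
        ⟨sub_nonneg.1 ((abs_nonneg _).trans (hbl c hc)), (hV.2.2 c hc).2⟩
    rw [List.map_cons, List.map_cons, List.alternatingSum_cons_cons]
    linarith [abs_add_le (φ a - φ b) (l.map φ).alternatingSum, hV.1.1]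

lemma alternatingSum_inv_nonneg {δ : ℝ} (hδ : 0 ≤ δ) :
    ∀ {l : List ℝ}, l.Pairwise (· + δ ≤ ·) → (∀ a ∈ l, 0 < a) →
      0 ≤ (l.map (·⁻¹)).alternatingSum
  | [], _, _ => by simp
  | [a], _, hpos => by simpa using (hpos a (by simp)).le
  | a :: b :: l, hl, hpos => by
    simp only [List.pairwise_cons, List.mem_cons, forall_eq_or_imp] at hl hpos
    have hinv : b⁻¹ ≤ a⁻¹ := inv_anti₀ hpos.1 (by linarith [hl.1.1])
    rw [List.map_cons, List.map_cons, List.alternatingSum_cons_cons]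
    linarith [alternatingSum_inv_nonneg hδ hl.2.2 hpos.2.2]

lemma inv_sub_inv_add_antitone {δ a A : ℝ} (hδ : 0 ≤ δ) (ha : 0 < a) (haA : a ≤ A) :
    δ / (A * (A + δ)) ≤ a⁻¹ - (a + δ)⁻¹ := by
  have hA := ha.trans_le haA
  rw [inv_sub_inv ha.ne' (by positivity), add_sub_cancel_left]
  gcongr

lemma le_alternatingSum_inv {δ A r : ℝ} (hδ : 0 ≤ δ) :
    ∀ {l : List ℝ}, l.Pairwise (· + δ ≤ ·) → (∀ a ∈ l, 0 < a) → r ∈ l → r ≤ A →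
      δ / (A * (A + δ)) ≤ (l.map (·⁻¹)).alternatingSum
  | [a], _, hpos, hr, hrA => by
    obtain rfl := List.mem_singleton.1 hr
    have hr0 := hpos r hr
    simpa using (inv_sub_inv_add_antitone hδ hr0 hrA).trans (sub_le_self _ (by positivity))
  | a :: b :: l, hl, hpos, hr, hrA => by
    have har : a ≤ r := by
      rcases List.mem_cons.1 hr with rfl | hr
      · exact le_rfl
      · linarith [(List.pairwise_cons.1 hl).1 r hr]
    simp only [List.pairwise_cons, List.mem_cons, forall_eq_or_imp] at hl hpos
    have hinv : b⁻¹ ≤ (a + δ)⁻¹ := inv_anti₀ (by linarith [hpos.1]) hl.1.1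
    rw [List.map_cons, List.map_cons, List.alternatingSum_cons_cons]
    linarith [alternatingSum_inv_nonneg hδ hl.2.2 hpos.2.2,
      inv_sub_inv_add_antitone hδ hpos.1 (har.trans hrA)]

lemma exists_append_of_pairwise_le {z : ℝ} :
    ∀ {l : List ℝ}, l.Pairwise (· ≤ ·) → z ∉ l →
      ∃ l₁ l₂, l = l₁ ++ l₂ ∧ (∀ s ∈ l₁, s < z) ∧ ∀ s ∈ l₂, z < s
  | [], _, _ => ⟨[], [], by simp⟩
  | a :: l, hl, hz => by
    obtain ⟨hal, hl⟩ := List.pairwise_cons.1 hl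
    obtain ⟨hza, hzl⟩ := not_or.1 (mt List.mem_cons.2 hz)
    rcases lt_or_gt_of_ne hza with hlt | hgt
    · exact ⟨[], a :: l, rfl, by simp, List.forall_mem_cons.2
        ⟨hlt, fun s hs => hlt.trans_le (hal s hs)⟩⟩
    · obtain ⟨l₁, l₂, rfl, h₁, h₂⟩ := exists_append_of_pairwise_le hl hzl
      exact ⟨a :: l₁, l₂, rfl, List.forall_mem_cons.2 ⟨hgt, h₁⟩, h₂⟩

lemma alternatingSum_map_neg {ι : Type*} (φ : ι → ℝ) (l : List ι) :
    (l.map fun a => -φ a).alternatingSum = -(l.map φ).alternatingSum := by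
  induction l with
  | nil => simp
  | cons a l ih =>
    rw [List.map_cons, List.map_cons, List.alternatingSum_cons, List.alternatingSum_cons, ih,
      neg_sub_neg, neg_sub]

-- Going away from `z`, the distances increase on either side, and the two sides enter the sum
-- with the same sign.
lemma alternatingSum_inv_sub_append {z : ℝ} {l₁ l₂ : List ℝ} :
    ((l₁ ++ l₂).map fun s => (z - s)⁻¹).alternatingSum =
      (-1) ^ (l₁.length + 1) * (((l₁.reverse.map (z - ·)).map (·⁻¹)).alternatingSum +
        ((l₂.map (· - z)).map (·⁻¹)).alternatingSum) := by
  have hright : (l₂.map fun s => (z - s)⁻¹) = l₂.map fun s => -(s - z)⁻¹ :=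
    List.map_congr_left fun s _ => by rw [← inv_neg, neg_sub]
  rw [List.map_append, List.alternatingSum_append, hright, alternatingSum_map_neg, List.length_map,
    List.map_map, List.map_map, List.map_reverse, List.alternatingSum_reverse, List.length_map]
  simp only [zsmul_eq_mul, Function.comp_def]
  push_cast
  rw [mul_add, ← mul_assoc, ← mul_pow, neg_one_mul, neg_neg, one_pow, one_mul, pow_succ]
  ring

lemma le_abs_alternatingSum_inv_sub {δ A z r : ℝ} (hδ : 0 ≤ δ) {l : List ℝ}
    (hl : l.Pairwise (· + δ ≤ ·)) (hz : z ∉ l) (hr : r ∈ l) (hrA : |z - r| ≤ A) :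
    δ / (A * (A + δ)) ≤ |(l.map fun s => (z - s)⁻¹).alternatingSum| := by
  obtain ⟨l₁, l₂, rfl, h₁, h₂⟩ := exists_append_of_pairwise_le
    (hl.imp fun h => (le_add_of_nonneg_right hδ).trans h) hz
  obtain ⟨hl₁, hl₂, -⟩ := List.pairwise_append.1 hl
  have hgap₁ : (l₁.reverse.map (z - ·)).Pairwise (· + δ ≤ ·) :=
    List.pairwise_map.2 (List.pairwise_reverse.2 (hl₁.imp fun h => by linarith))
  have hgap₂ : (l₂.map (· - z)).Pairwise (· + δ ≤ ·) :=
    List.pairwise_map.2 (hl₂.imp fun h => by linarith)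
  have hpos₁ : ∀ d ∈ l₁.reverse.map (z - ·), 0 < d :=
    List.forall_mem_map.2 fun s hs => sub_pos.2 (h₁ s (List.mem_reverse.1 hs))
  have hpos₂ : ∀ d ∈ l₂.map (· - z), 0 < d :=
    List.forall_mem_map.2 fun s hs => sub_pos.2 (h₂ s hs)
  have hnonneg₁ := alternatingSum_inv_nonneg hδ hgap₁ hpos₁
  have hnonneg₂ := alternatingSum_inv_nonneg hδ hgap₂ hpos₂
  rw [alternatingSum_inv_sub_append, abs_mul, abs_pow, abs_neg, abs_one, one_pow, one_mul,
    abs_of_nonneg (add_nonneg hnonneg₁ hnonneg₂)]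
  rcases List.mem_append.1 hr with hr₁ | hr₂
  · rw [abs_of_pos (sub_pos.2 (h₁ r hr₁))] at hrA
    exact le_add_of_le_of_nonneg (le_alternatingSum_inv hδ hgap₁ hpos₁
      (List.mem_map_of_mem (List.mem_reverse.2 hr₁)) hrA) hnonneg₂
  · rw [abs_sub_comm, abs_of_pos (sub_pos.2 (h₂ r hr₂))] at hrA
    exact le_add_of_nonneg_of_le hnonneg₁
      (le_alternatingSum_inv hδ hgap₂ hpos₂ (List.mem_map_of_mem (f := (· - z)) hr₂) hrA)

end AlternatingSum

/-! ### Berrut's interpolant -/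

section Berrut

variable {n : ℕ} {t y : Fin n → ℝ} {F : Finset (Fin n)} {z : ℝ}

lemma berrut_node (ht : Function.Injective t) {v : Fin n} (hv : v ∈ F) :
    berrut t y F (t v) = y v := by
  have h : ∃ w ∈ F, t w = t v := ⟨v, hv, rfl⟩
  rw [berrut, dif_pos h, ht h.choose_spec.2]

lemma berrut_of_ne (hz : ∀ v ∈ F, t v ≠ z) :
    berrut t y F z = (∑ v ∈ F, alternatingSign F v / (z - t v) * y v) /
      ∑ v ∈ F, alternatingSign F v / (z - t v) := by
  rw [berrut, dif_neg]
  push Not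
  exact hz

lemma berrut_empty (t y : Fin n → ℝ) (z : ℝ) : berrut t y ∅ z = 0 := by
  rw [berrut_of_ne (by simp), Finset.sum_empty, zero_div]

lemma le_abs_sum_alternatingSign_div {δ A : ℝ} (hδ : 0 ≤ δ)
    (ht : ∀ v w, v < w → δ ≤ t w - t v) (hz : ∀ v ∈ F, t v ≠ z)
    (hA : ∃ v ∈ F, |z - t v| ≤ A) :
    δ / (A * (A + δ)) ≤ |∑ v ∈ F, alternatingSign F v / (z - t v)| := by
  obtain ⟨v, hv, hvA⟩ := hA
  have hgap : (F.sort.map t).Pairwise (· + δ ≤ ·) :=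
    List.pairwise_map.2 (F.sortedLT_sort.pairwise.imp fun h => by linarith [ht _ _ h])
  have hzF : z ∉ F.sort.map t := by simpa using hz
  have hmem : t v ∈ F.sort.map t := List.mem_map_of_mem (by simpa using hv)
  simpa only [div_eq_mul_inv, sum_alternatingSign_mul, List.map_map, Function.comp_def]
    using le_abs_alternatingSum_inv_sub hδ hgap hzF hmem hvA

lemma exists_pos_le_sub (ht : StrictMono t) : ∃ δ > 0, ∀ v w, v < w → δ ≤ t w - t v := by
  have hgap : ∀ᶠ δ in 𝓝[>] (0 : ℝ), ∀ v w, v < w → δ ≤ t w - t v := by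
    simp only [eventually_all]
    exact fun v w hvw => (eventually_le_nhds (sub_pos.2 (ht hvw))).filter_mono nhdsWithin_le_nhds
  obtain ⟨δ, hδ, hpos⟩ := (hgap.and self_mem_nhdsWithin).exists
  exact ⟨δ, hpos, hδ⟩

lemma sum_alternatingSign_div_ne_zero (ht : StrictMono t) (hF : F.Nonempty)
    (hz : ∀ v ∈ F, t v ≠ z) : ∑ v ∈ F, alternatingSign F v / (z - t v) ≠ 0 := by
  obtain ⟨δ, hδ, hgap⟩ := exists_pos_le_sub ht
  obtain ⟨v, hv⟩ := hF
  have hpos : 0 < |z - t v| := abs_pos.2 (sub_ne_zero.2 (hz v hv).symm)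
  refine abs_pos.1 <|
    lt_of_lt_of_le ?_ (le_abs_sum_alternatingSign_div hδ.le hgap hz ⟨v, hv, le_rfl⟩)
  positivity

lemma sum_mul_prod_erase_of_ne (c : Fin n → ℝ) (hz : ∀ v ∈ F, t v ≠ z) :
    ∑ v ∈ F, c v * ∏ w ∈ F.erase v, (z - t w) =
      (∑ v ∈ F, c v / (z - t v)) * ∏ w ∈ F, (z - t w) := by
  rw [Finset.sum_mul]
  refine Finset.sum_congr rfl fun v hv => ?_
  rw [← Finset.mul_prod_erase F _ hv, ← mul_assoc, div_mul_cancel₀ _ (sub_ne_zero.2 (hz v hv).symm)]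

lemma sum_mul_prod_erase_node (c : Fin n → ℝ) {v : Fin n} (hv : v ∈ F) :
    ∑ u ∈ F, c u * ∏ w ∈ F.erase u, (t v - t w) = c v * ∏ w ∈ F.erase v, (t v - t w) := by
  refine Finset.sum_eq_single_of_mem v hv fun u _ hu => ?_
  rw [Finset.prod_eq_zero (Finset.mem_erase.2 ⟨hu.symm, hv⟩) (sub_self _), mul_zero]

lemma sum_alternatingSign_mul_prod_erase_ne_zero (ht : StrictMono t) (hF : F.Nonempty) (z : ℝ) :
    ∑ v ∈ F, alternatingSign F v * ∏ w ∈ F.erase v, (z - t w) ≠ 0 := by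
  by_cases hz : ∀ v ∈ F, t v ≠ z
  · rw [sum_mul_prod_erase_of_ne _ hz]
    exact mul_ne_zero (sum_alternatingSign_div_ne_zero ht hF hz)
      (Finset.prod_ne_zero_iff.2 fun w hw => sub_ne_zero.2 (hz w hw).symm)
  · push Not at hz
    obtain ⟨v, hv, rfl⟩ := hz
    rw [sum_mul_prod_erase_node _ hv]
    refine mul_ne_zero (pow_ne_zero _ (by norm_num)) (Finset.prod_ne_zero_iff.2 fun w hw => ?_)
    exact sub_ne_zero.2 (ht.injective.ne (Finset.ne_of_mem_erase hw).symm)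

lemma berrut_eq_div (ht : StrictMono t) (hF : F.Nonempty) (z : ℝ) :
    berrut t y F z =
      (∑ v ∈ F, alternatingSign F v * y v * ∏ w ∈ F.erase v, (z - t w)) /
        ∑ v ∈ F, alternatingSign F v * ∏ w ∈ F.erase v, (z - t w) := by
  have hne := sum_alternatingSign_mul_prod_erase_ne_zero ht hF z
  by_cases hz : ∀ v ∈ F, t v ≠ z
  · rw [berrut_of_ne hz, sum_mul_prod_erase_of_ne _ hz, sum_mul_prod_erase_of_ne _ hz,
      mul_div_mul_right _ _ (Finset.prod_ne_zero_iff.2 fun w hw => sub_ne_zero.2 (hz w hw).symm)]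
    simp only [div_mul_eq_mul_div]
  · push Not at hz
    obtain ⟨v, hv, rfl⟩ := hz
    rw [sum_mul_prod_erase_node _ hv] at hne ⊢
    rw [berrut_node ht.injective hv, sum_mul_prod_erase_node _ hv, eq_div_iff hne]
    ring

lemma contDiff_berrut {k : WithTop ℕ∞} (ht : StrictMono t) (hF : F.Nonempty) :
    ContDiff ℝ k (berrut t y F) := by
  have hpoly (c : Fin n → ℝ) :
      ContDiff ℝ k fun z => ∑ v ∈ F, c v * ∏ w ∈ F.erase v, (z - t w) :=
    ContDiff.sum fun v _ => contDiff_const.mul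
      (contDiff_prod fun w _ => contDiff_id.sub contDiff_const)
  rw [funext fun z => berrut_eq_div (y := y) ht hF z]
  exact (hpoly _).div (hpoly _) (sum_alternatingSign_mul_prod_erase_ne_zero ht hF)

end Berrut

section BerrutError

variable {n : ℕ} {t : Fin n → ℝ} {F : Finset (Fin n)} {g : ℝ → ℝ} {z : ℝ}

lemma exists_sum_mul_slope_eq {ι : Type*} {s : Finset ι} {t : ι → ℝ} {S : Set ℝ} (c : ι → ℝ)
    (hS : Convex ℝ S) (hg : ∀ r ∈ S, DifferentiableAt ℝ g r) (hz : z ∈ S) (ht : ∀ i ∈ s, t i ∈ S)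
    (hne : ∀ i ∈ s, t i ≠ z) :
    ∃ θ ∈ Set.Ioo (0 : ℝ) 1,
      ∑ i ∈ s, c i * slope g z (t i) = ∑ i ∈ s, c i * deriv g (z + θ * (t i - z)) := by
  have hmem {i : ι} (hi : i ∈ s) {θ : ℝ} (hθ : θ ∈ Set.Icc (0 : ℝ) 1) : z + θ * (t i - z) ∈ S :=
    hS.add_smul_sub_mem hz (ht i hi) hθ
  have hderiv {θ : ℝ} (hθ : θ ∈ Set.Icc (0 : ℝ) 1) :
      HasDerivAt (fun θ => ∑ i ∈ s, c i * ((g (z + θ * (t i - z)) - g z) / (t i - z)))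
        (∑ i ∈ s, c i * deriv g (z + θ * (t i - z))) θ := by
    refine HasDerivAt.fun_sum fun i hi => HasDerivAt.const_mul _ ?_
    have hline : HasDerivAt (fun θ => z + θ * (t i - z)) (t i - z) θ := by
      simpa using ((hasDerivAt_id θ).mul_const (t i - z)).const_add z
    have h := (((hg _ (hmem hi hθ)).hasDerivAt.comp θ hline).sub_const (g z)).div_const (t i - z)
    rwa [mul_div_cancel_right₀ _ (sub_ne_zero.2 (hne i hi))] at h
  obtain ⟨θ, hθ, hslope⟩ := exists_hasDerivAt_eq_slope _ _ zero_lt_one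
    (fun θ hθ => (hderiv hθ).continuousAt.continuousWithinAt)
    (fun θ hθ => hderiv (Set.Ioo_subset_Icc_self hθ))
  refine ⟨θ, hθ, ?_⟩
  rw [hslope]
  simp [slope_def_field]

lemma MemH2.integrableOn (hg : MemH2 g) : IntegrableOn (deriv (deriv g)) Omega := by
  have : IsFiniteMeasure (volume.restrict Omega) := ⟨by simp [Omega]⟩
  exact hg.memLp.integrable one_le_two

lemma MemH2.abs_deriv_sub_le (hg : MemH2 g) {a b : ℝ} (ha : a ∈ Omega) (hb : b ∈ Omega)
    (hab : a ≤ b) :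
    |deriv g a - deriv g b| ≤ (∫ r in (0 : ℝ)..b, |deriv (deriv g) r|) -
      ∫ r in (0 : ℝ)..a, |deriv (deriv g) r| := by
  have hint {c d : ℝ} (hc : c ∈ Omega) (hd : d ∈ Omega) :
      IntervalIntegrable (fun r => |deriv (deriv g) r|) volume c d :=
    (hg.absolutelyContinuous c hc d hd).intervalIntegrable_deriv.abs
  have h0 : (0 : ℝ) ∈ Omega := by norm_num [Omega]
  rw [intervalIntegral.integral_interval_sub_left (hint h0 hb) (hint h0 ha), abs_sub_comm,
    ← (hg.absolutelyContinuous a ha b hb).integral_deriv_eq_sub]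
  exact intervalIntegral.abs_integral_le_integral_abs hab

lemma MemH2.abs_intervalIntegral_le (hg : MemH2 g) {a b : ℝ} (ha : a ∈ Omega) (hb : b ∈ Omega) :
    |(∫ r in a..b, |deriv (deriv g) r|)| ≤ ∫ r in Omega, |deriv (deriv g) r| := by
  rw [intervalIntegral.abs_integral_eq_abs_integral_uIoc,
    abs_of_nonneg (integral_nonneg fun _ => abs_nonneg _)]
  exact setIntegral_mono_set hg.integrableOn.abs (.of_forall fun _ => abs_nonneg _)
    (.of_forall (Set.uIoc_subset_uIcc.trans
      (Set.OrdConnected.uIcc_subset Set.ordConnected_Ioo ha hb)))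

/-- A bound, by the total variation of `g'`, for `g'` and for its alternating sums over
increasing points of `Ω`. -/
noncomputable def derivBound (g : ℝ → ℝ) : ℝ := |deriv g 0| + 3 * ∫ r in Omega, |deriv (deriv g) r|

lemma derivBound_nonneg (g : ℝ → ℝ) : 0 ≤ derivBound g :=
  add_nonneg (abs_nonneg _) (mul_nonneg (by norm_num) (integral_nonneg fun _ => abs_nonneg _))

lemma MemH2.abs_sum_alternatingSign_mul_deriv_le (hg : MemH2 g) {s : Fin n → ℝ}
    (hs : Monotone s) (hsΩ : ∀ v, s v ∈ Omega) (F : Finset (Fin n)) :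
    |∑ v ∈ F, alternatingSign F v * deriv g (s v)| ≤ derivBound g := by
  set L := ∫ r in Omega, |deriv (deriv g) r|
  have hL : 0 ≤ L := integral_nonneg fun _ => abs_nonneg _
  have h0 : (0 : ℝ) ∈ Omega := by norm_num [Omega]
  have hvar (v : Fin n) : |(∫ r in (0 : ℝ)..s v, |deriv (deriv g) r|)| ≤ L :=
    hg.abs_intervalIntegral_le h0 (hsΩ v)
  have hderiv (v : Fin n) : |deriv g (s v)| ≤ |deriv g 0| + L := by
    have h : |deriv g (s v) - deriv g 0| ≤ L := by
      rw [← (hg.absolutelyContinuous 0 h0 (s v) (hsΩ v)).integral_deriv_eq_sub]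
      exact (intervalIntegral.norm_integral_le_abs_integral_norm (f := deriv (deriv g))).trans
        (hvar v)
    linarith [abs_sub_abs_le_abs_sub (deriv g (s v)) (deriv g 0)]
  rw [sum_alternatingSign_mul]
  refine (abs_alternatingSum_map_le (V := fun v => ∫ r in (0 : ℝ)..s v, |deriv (deriv g) r|)
    (m := -L) (T := L) (add_nonneg (abs_nonneg _) hL) (neg_le_self hL)
    (F.sortedLT_sort.pairwise.imp fun h => hg.abs_deriv_sub_le (hsΩ _) (hsΩ _) (hs h.le))
    (fun v _ => hderiv v) fun v _ => abs_le.1 (hvar v)).trans_eq ?_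
  rw [derivBound]
  ring

lemma berrut_comp_sub_eq (ht : StrictMono t) (hF : F.Nonempty) (hz : ∀ v ∈ F, t v ≠ z) :
    berrut t (fun v => g (t v)) F z - g z =
      -(∑ v ∈ F, alternatingSign F v * slope g z (t v)) /
        ∑ v ∈ F, alternatingSign F v / (z - t v) := by
  rw [berrut_of_ne hz, eq_div_iff (sum_alternatingSign_div_ne_zero ht hF hz), sub_mul,
    div_mul_cancel₀ _ (sum_alternatingSign_div_ne_zero ht hF hz), Finset.mul_sum,
    ← Finset.sum_sub_distrib, ← Finset.sum_neg_distrib]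
  refine Finset.sum_congr rfl fun v _ => ?_
  rw [slope_def_field, ← neg_sub z (t v), div_neg]
  ring

-- The differences `g (t v) - g z` cancel the denominators `z - t v`, which leaves an alternating
-- sum of slopes; a single mean value theorem, applied to all slopes at once, turns it into an
-- alternating sum of `g'` over increasing points.
lemma abs_berrut_sub_le (hg : MemH2 g) (ht : StrictMono t) (htΩ : ∀ v, t v ∈ Omega)
    (hz : z ∈ Omega) {δ A : ℝ} (hδ : 0 < δ) (hgap : ∀ v w, v < w → δ ≤ t w - t v)
    (hA : ∃ v ∈ F, |z - t v| ≤ A) :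
    |berrut t (fun v => g (t v)) F z - g z| ≤ derivBound g * (A * (A + δ) / δ) := by
  obtain ⟨v, hv, hvA⟩ := id hA
  by_cases hne : ∀ v ∈ F, t v ≠ z
  · have hApos : 0 < A := (abs_pos.2 (sub_ne_zero.2 (hne v hv).symm)).trans_le hvA
    obtain ⟨θ, hθ, hslope⟩ := exists_sum_mul_slope_eq (alternatingSign F) (convex_Ioo (-1) 1)
      (fun r hr => hg.differentiableAt hr) hz (fun v _ => htΩ v) hne
    have hs : Monotone fun v => z + θ * (t v - z) := fun v w hvw => by
      have := mul_le_mul_of_nonneg_left (sub_le_sub_right (ht.monotone hvw) z) hθ.1.le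
      exact add_le_add_right this z
    have hsΩ (v : Fin n) : z + θ * (t v - z) ∈ Omega :=
      (convex_Ioo (-1) 1).add_smul_sub_mem hz (htΩ v) (Set.Ioo_subset_Icc_self hθ)
    rw [berrut_comp_sub_eq ht ⟨v, hv⟩ hne, hslope, abs_div, abs_neg]
    refine (div_le_div₀ (derivBound_nonneg g) (hg.abs_sum_alternatingSign_mul_deriv_le hs hsΩ F)
      (by positivity) (le_abs_sum_alternatingSign_div hδ.le hgap hne hA)).trans_eq ?_
    rw [div_eq_mul_inv, inv_div]
  · push Not at hne
    obtain ⟨w, hw, rfl⟩ := hne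
    have hA0 : 0 ≤ A := (abs_nonneg _).trans hvA
    rw [berrut_node ht.injective hw, sub_self, abs_zero]
    exact mul_nonneg (derivBound_nonneg g) (by positivity)

end BerrutError

/-! ### The BACC decoder -/

section Bacc

variable {p : ℝ} {K : ℕ} {x α : Fin K → ℝ} {β : (N : ℕ) → Fin N → ℝ} {B : ℝ} {f enc : ℝ → ℝ}

lemma IsQuasiUniform.sq_baccDecoder_sub_le {N : ℕ} {β : Fin N → ℝ} (hβ : IsQuasiUniform B β)
    (hg : MemH2 (f ∘ enc)) {F : Finset (Fin N)} {z : ℝ} (hz : z ∈ Omega) {ℓ : ℝ} (hℓ : 1 ≤ ℓ)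
    {c : ℝ} (hc : 0 ≤ c) (hF : ∃ v ∈ F, |z - β v| ≤ c * (ℓ / N)) :
    (baccDecoder f enc β F z - f (enc z)) ^ 2 ≤
      (derivBound (f ∘ enc) * (c * (c * B + 1))) ^ 2 * (ℓ ^ 4 / (N : ℝ) ^ 2) := by
  have hN : (0 : ℝ) < N := two_pos.trans_le hβ.cast_two_le
  have hB := hβ.pos
  have hD := derivBound_nonneg (f ∘ enc)
  have hfactor : c * (ℓ / N) * (c * (ℓ / N) + 1 / (B * N)) / (1 / (B * N)) ≤
      c * (c * B + 1) * (ℓ ^ 2 / N) := by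
    calc c * (ℓ / N) * (c * (ℓ / N) + 1 / (B * N)) / (1 / (B * N))
        = c * ℓ * (c * B * ℓ + 1) / N := by field_simp
      _ ≤ c * ℓ * (c * B * ℓ + ℓ) / N := by gcongr
      _ = c * (c * B + 1) * (ℓ ^ 2 / N) := by ring
  have herr : |baccDecoder f enc β F z - f (enc z)| ≤
      derivBound (f ∘ enc) * (c * (c * B + 1) * (ℓ ^ 2 / N)) :=
    (abs_berrut_sub_le hg hβ.strictMono hβ.mem_Omega hz (by positivity)
      (fun _ _ h => hβ.one_div_le_sub h) hF).trans (mul_le_mul_of_nonneg_left hfactor hD)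
  calc (baccDecoder f enc β F z - f (enc z)) ^ 2
      ≤ (derivBound (f ∘ enc) * (c * (c * B + 1) * (ℓ ^ 2 / N))) ^ 2 :=
        sq_le_sq' (neg_le_of_abs_le herr) (le_of_abs_le herr)
    _ = (derivBound (f ∘ enc) * (c * (c * B + 1))) ^ 2 * (ℓ ^ 4 / (N : ℝ) ^ 2) := by ring

lemma eventually_bacc_sq_error_le (hp0 : 0 < p) (hp1 : p < 1) (hα : ∀ k, α k ∈ Omega)
    (hβ : ∀ᶠ N in atTop, IsQuasiUniform B (β N)) (henc : ∀ k, enc (α k) = x k)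
    (hg : MemH2 (f ∘ enc)) :
    ∀ᶠ N in atTop, ∀ F k, HasNeighbours (β N) F (28 * B * (Real.logb (1 / p) N / N)) (α k) →
      (baccDecoder f enc (β N) F (α k) - f (x k)) ^ 2 ≤
        (derivBound (f ∘ enc) * (28 * B * (28 * B * B + 1))) ^ 2 *
          (Real.logb (1 / p) N ^ 4 / (N : ℝ) ^ 2) := by
  filter_upwards [hβ, (tendsto_logb_natCast hp0 hp1).eventually_ge_atTop 1] with N hβN hlog F k hk
  obtain ⟨⟨v, hv, hvd, hvz⟩, -⟩ := hk
  rw [← henc k]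
  refine hβN.sq_baccDecoder_sub_le hg (hα k) hlog (by linarith [hβN.pos]) ⟨v, hv, ?_⟩
  rw [abs_of_nonneg (sub_nonneg.2 hvz)]
  linarith

lemma exists_eventually_bacc_sq_error_le (hα : ∀ k, α k ∈ Omega)
    (hβ : ∀ᶠ N in atTop, IsQuasiUniform B (β N)) (henc : ∀ k, enc (α k) = x k)
    (hg : MemH2 (f ∘ enc)) :
    ∃ D : ℝ, ∀ᶠ N in atTop, ∀ F k,
      (baccDecoder f enc (β N) F (α k) - f (x k)) ^ 2 ≤ D * (N : ℝ) ^ 2 := by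
  set D₁ := (derivBound (f ∘ enc) * (2 * (2 * B + 1))) ^ 2
  set D₂ := ∑ k, f (x k) ^ 2
  have hD₂ : 0 ≤ D₂ := by positivity
  refine ⟨D₁ + D₂, hβ.mono fun N hβN F k => ?_⟩
  have hN : (1 : ℝ) ≤ N := one_le_two.trans hβN.cast_two_le
  have hN2 : (1 : ℝ) ≤ (N : ℝ) ^ 2 := one_le_pow₀ hN
  rcases F.eq_empty_or_nonempty with rfl | ⟨v, hv⟩
  · have hfk : f (x k) ^ 2 ≤ D₂ :=
      Finset.single_le_sum (f := fun k => f (x k) ^ 2) (fun _ _ => sq_nonneg _) (Finset.mem_univ k)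
    rw [baccDecoder, berrut_empty, zero_sub, neg_sq]
    nlinarith [sq_nonneg (derivBound (f ∘ enc) * (2 * (2 * B + 1)))]
  · have hwidth : |α k - β N v| ≤ 2 * ((N : ℝ) / N) := by
      rw [div_self (by positivity), abs_le]
      constructor <;> linarith [(hα k).1, (hα k).2, (hβN.mem_Omega v).1, (hβN.mem_Omega v).2]
    have hlarge := hβN.sq_baccDecoder_sub_le hg (hα k) hN zero_le_two ⟨v, hv, hwidth⟩
    rw [henc k] at hlarge
    have hrate : (N : ℝ) ^ 4 / (N : ℝ) ^ 2 = (N : ℝ) ^ 2 := by field_simp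
    rw [hrate] at hlarge
    nlinarith

end Bacc

lemma lipschitzWith_of_abs_deriv_le {φ : ℝ → ℝ} {η : ℝ} (hφ : Differentiable ℝ φ)
    (hη : ∀ y, |deriv φ y| ≤ η) : LipschitzWith η.toNNReal φ :=
  lipschitzWith_of_nnnorm_deriv_le hφ fun y => NNReal.le_toNNReal_of_coe_le (hη y)

lemma memH2_comp_baccEncoder {K : ℕ} (hK : 0 < K) {x α : Fin K → ℝ} (hα : StrictMono α)
    {f : ℝ → ℝ} (hf : ContDiff ℝ 2 f) : MemH2 (f ∘ baccEncoder α x) :=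
  memH2_comp (hf.differentiable two_ne_zero) (ContDiff.deriv' (n := 1) hf).locallyLipschitz
    (contDiff_berrut hα ⟨⟨0, hK⟩, Finset.mem_univ _⟩)

end CodedComputing

open CodedComputing in
theorem corollary1_general (p : ℝ) (hp0 : 0 < p) (hp1 : p < 1) (K : ℕ) (hK : 0 < K)
    (x α : Fin K → ℝ) (hα : ∀ k, α k ∈ Omega) (β : (N : ℕ) → Fin N → ℝ) (B : ℝ)
    (hβ : ∀ᶠ N in atTop, IsQuasiUniform B (β N)) (f enc : ℝ → ℝ) (henc : ∀ k, enc (α k) = x k)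
    (hg : MemH2 (f ∘ enc)) :
    (∀ lam : ℕ → ℝ, (∀ N, 1 ≤ N → 0 ≤ lam N ∧ lam N ≤ 1 / (N : ℝ) ^ 4) →
      ∀ dec : (N : ℕ) → Finset (Fin N) → ℝ → ℝ,
      (∀ N F, F.Nonempty → IsLetccDecoder f enc (β N) (lam N) F (dec N F)) →
      ConvergesWithHighProbability p (fun N F => approxError α x f (dec N F))
        (fun N => Real.logb (1 / p) N ^ 3 / (N : ℝ) ^ 3) ∧
      ((∃ M : ℝ, ∀ N F, F.card < 2 → ∀ k, |dec N F (α k)| ≤ M) →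
        ConvergesInMean p (fun N F => approxError α x f (dec N F))
          (fun N => Real.logb (1 / p) N ^ 3 / (N : ℝ) ^ 3))) ∧
    (ConvergesWithHighProbability p
        (fun N F => approxError α x f (baccDecoder f enc (β N) F))
        (fun N => Real.logb (1 / p) N ^ 4 / (N : ℝ) ^ 2) ∧
      ConvergesInMean p (fun N F => approxError α x f (baccDecoder f enc (β N) F))
        (fun N => Real.logb (1 / p) N ^ 4 / (N : ℝ) ^ 2)) := by
  constructor
  · intro lam hlam dec hdec
    have hnear := eventually_letcc_sq_error_le hp0 hp1 hβ henc hg hlam hdec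
    refine ⟨convergesWithHighProbability_approxError hp0 hp1 hK hα hβ three_ne_zero hnear,
      fun hbdd => ?_⟩
    obtain ⟨D, hfar⟩ := exists_eventually_letcc_sq_error_le hα hβ henc hg hlam hdec hbdd
    exact convergesInMean_approxError hp0 hp1 hK hα hβ three_ne_zero le_rfl hnear hfar
  · have hnear := eventually_bacc_sq_error_le hp0 hp1 hα hβ henc hg
    obtain ⟨D, hfar⟩ := exists_eventually_bacc_sq_error_le hα hβ henc hg
    exact ⟨convergesWithHighProbability_approxError hp0 hp1 hK hα hβ two_ne_zero hnear,
      convergesInMean_approxError hp0 hp1 hK hα hβ two_ne_zero (by norm_num) hnear hfar⟩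

theorem corollary1
    -- straggler probability
    (p : ℝ) (hp0 : 0 < p) (hp1 : p < 1)
    -- data points and encoder mapping points, fixed
    (K : ℕ) (hK : 0 < K) (x α : Fin K → ℝ) (hα : StrictMono α)
    (hαΩ : ∀ k, α k ∈ CodedComputing.Omega)
    -- decoder mapping points, for each number `N` of servers
    (β : (N : ℕ) → Fin N → ℝ) (hβ : ∀ N, StrictMono (β N))
    (hβΩ : ∀ N n, β N n ∈ CodedComputing.Omega)
    (B : ℝ) (hB : 0 < B)
    (hβB : ∀ N, 2 ≤ N → CodedComputing.deltaMax (β N) / CodedComputing.deltaMin (β N) ≤ B) :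
    -- LeTCC
    (∀ (f : ℝ → ℝ) (ν : NNReal) (η : ℝ), LipschitzWith ν f → Differentiable ℝ f →
      Differentiable ℝ (deriv f) → (∀ y, |deriv (deriv f) y| ≤ η) →
      ∀ enc : ℝ → ℝ, CodedComputing.IsNaturalSpline α enc → (∀ k, enc (α k) = x k) →
      ∀ lam : ℕ → ℝ, (∀ N, 1 ≤ N → 0 ≤ lam N ∧ lam N ≤ 1 / (N : ℝ) ^ 4) →
      ∀ dec : (N : ℕ) → Finset (Fin N) → ℝ → ℝ,
      (∀ N F, F.Nonempty → CodedComputing.IsLetccDecoder f enc (β N) (lam N) F (dec N F)) →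
      CodedComputing.ConvergesWithHighProbability p
        (fun N F => CodedComputing.approxError α x f (dec N F))
        (fun N => Real.logb (1 / p) N ^ 3 / (N : ℝ) ^ 3) ∧
      -- with fewer than two responses the minimiser is not unique: the rule that selects it
      -- has to keep the outputs bounded
      ((∃ M : ℝ, ∀ N F, F.card < 2 → ∀ k, |dec N F (α k)| ≤ M) →
        CodedComputing.ConvergesInMean p
          (fun N F => CodedComputing.approxError α x f (dec N F))
          (fun N => Real.logb (1 / p) N ^ 3 / (N : ℝ) ^ 3))) ∧
    -- BACC
    (∀ f : ℝ → ℝ, ContDiff ℝ 2 f →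
      CodedComputing.ConvergesWithHighProbability p
        (fun N F => CodedComputing.approxError α x f
          (CodedComputing.baccDecoder f (CodedComputing.baccEncoder α x) (β N) F))
        (fun N => Real.logb (1 / p) N ^ 4 / (N : ℝ) ^ 2) ∧
      CodedComputing.ConvergesInMean p
        (fun N F => CodedComputing.approxError α x f
          (CodedComputing.baccDecoder f (CodedComputing.baccEncoder α x) (β N) F))
        (fun N => Real.logb (1 / p) N ^ 4 / (N : ℝ) ^ 2)) := by
  have hquasi : ∀ᶠ N in Filter.atTop, CodedComputing.IsQuasiUniform B (β N) :=
    (Filter.eventually_ge_atTop 2).mono fun N hN => ⟨hN, hβ N, hβΩ N, hβB N hN⟩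
  refine ⟨fun f ν η _ hf hf' hη enc henc hencα => ?_, fun f hf => ?_⟩
  · exact (corollary1_general p hp0 hp1 K hK x α hαΩ β B hquasi f enc hencα
      (CodedComputing.memH2_comp hf
        (CodedComputing.lipschitzWith_of_abs_deriv_le hf' hη).locallyLipschitz henc.contDiff)).1
  · exact (corollary1_general p hp0 hp1 K hK x α hαΩ β B hquasi f _
      (fun k => CodedComputing.berrut_node hα.injective (Finset.mem_univ k))
      (CodedComputing.memH2_comp_baccEncoder hK hα hf)).2
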